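/- \textbf{Setting.} Let $\Theta$ be a random root-cause with a known prior of full support on a finite set of $n$ elements, let $r$ map root-causes to a finite set $\mathcal Y$ of $t$ target values, and let $Y=r(\Theta)$. There are finitely many tests $e\in\mathcal V$ with binary outcomes $X_e$ that are conditionally independent given $\Theta$, with known likelihoods. The noise rate of a test does not depend on the root-cause: $1-\max_x \mathbb P(X_e=x\mid\theta)=\epsilon_e$ for all $\theta$. A partial realization $\psi$ is a set of performed tests with their outcomes. A policy maps each partial realization to the next test, or stops. Its cost is the largest number of tests on a path of positive probability. Write $p^{\mathrm{MAP}}_{\mathrm{err}}(\psi)=1-\max_y\mathbb P(y\mid\psi)$. The error $p_{\mathrm{err}}(\pi)$ of a policy $\pi$ is the expectation of $p^{\mathrm{MAP}}_{\mathrm{err}}$ at the end of $\pi$. Logarithms are to base $2$, $0\log\frac10=0$, and $\mathbb H_2(x)=-x\log x-(1-x)\log(1-x)$. Let $E$ be the set of ordered pairs $(\theta,\theta')$ with $r(\theta)\ne r(\theta')$, and $$f_{\mathrm{aux}}(\psi)=\sum_{(\theta,\theta')\in E}\mathbb P(\theta\mid\psi)\,\mathbb P(\theta'\mid\psi)\log\frac{1}{\mathbb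 P(\theta\mid\psi)\,\mathbb P(\theta'\mid\psi)}+c\sum_{y\in\mathcal Y}\mathbb H_2\big(\mathbb P(y\mid\psi)\big).$$ Let $\lambda_{\theta,x_e}=\mathbb P(X_e=x_e\mid\theta)/\max_{x}\mathbb P(X_e=x\mid\theta)$ and $w_{\theta\theta'}(\psi)=\mathbb P(\theta,\psi)\,\mathbb P(\theta',\psi)$. ECED performs one test per step until all tests are performed: having observed $\psi$, it picks among the tests not yet performed one that maximizes $$\Delta_{\mathrm{ECED}}(X_e\mid\psi)=\mathbb E_{x_e\mid\psi}\Big[\sum_{(\theta,\theta')\in E}w_{\theta\theta'}(\psi)\Big((1-\lambda_{\theta,x_e}\lambda_{\theta',x_e})-\big(1-\max_{\theta''}\lambda_{\theta'',x_e}^2\big)\Big)\Big].$$ \textbf{Key Lemma.} Let $\eta\in(0,1)$ and $\delta_{\mathrm g}>0$. Put $c=8(\log(2n^2/\eta))^2$ and $c_\delta=(6c+8)\log(n/\delta_{\mathrm g})$. Let $\mathrm{OPT}(\delta_{\mathrm{opt}})$ be a policy of minimal cost among the policies with $p_{\mathrm{err}}\le\delta_{\mathrm{opt}}$, and let $k\ge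 1$ be its cost. Let $\psi_\ell$ be the random partial realization after $\ell$ steps of ECED, write $f^{\mathrm{avg}}_{\mathrm{aux}}(\ell)=\mathbb E[f_{\mathrm{aux}}(\psi_\ell)]$, and assume $\mathbb E[p^{\mathrm{MAP}}_{\mathrm{err}}(\psi_\ell)]\ge\delta_{\mathrm g}$. Then $$f^{\mathrm{avg}}_{\mathrm{aux}}(\ell)-f^{\mathrm{avg}}_{\mathrm{aux}}(\ell+1)\ \ge\ \frac{f^{\mathrm{avg}}_{\mathrm{aux}}(\ell)-\delta_{\mathrm{opt}}\,c_\delta}{k}\cdot\frac{c_\epsilon}{c_\delta}-c_{\eta,\epsilon}$$ in each of the following two cases: (1) all tests have the same noise rate $\epsilon$, $c_\epsilon=(1-2\epsilon)^2/16$ and $c_{\eta,\epsilon}=2t(1-2\epsilon)^2\eta$; (2) the noise rates $\epsilon_e$ are arbitrary, $c_\epsilon=\min_e(1-2\epsilon_e)^2/16$, $c_{\eta,\epsilon}=\max_e 2t(1-2\epsilon_e)^2\eta$, and ECED maximizes, instead of $\Delta_{\mathrm{ECED}}$, the quantity in which the expected offset $\mathbb E_{x_e\mid\psi}\big[\sum_{E}w_{\theta\theta'}(\psi)(1-\max_{\theta''}\lambda_{\theta'',x_e}^2)\big]$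 is replaced by $\epsilon_e\big(1-(\tfrac{\epsilon_e}{1-\epsilon_e})^2\big)\sum_{E}w_{\theta\theta'}(\psi)$. -/

import Mathlib

/-!
Bayesian active learning with noisy binary tests: root-causes in `Θ`, target values in `Y`,
tests in `V`, and every test has an outcome in `Bool`.
-/

/-- The basic model.  The type `Θ` is the support of the root-cause variable, `r` maps a root-cause
to its target value, and `lik e θ x` is the probability that test `e` has outcome `x` given the
root-cause `θ`.  The tests are conditionally independent given the root-cause. -/
structure TestModel (Θ V Y : Type*) [Fintype Θ] where
  prior : Θ → ℝ
  prior_pos : ∀ θ, 0 < prior θ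
  prior_sum : ∑ θ, prior θ = 1
  r : Θ → Y
  lik : V → Θ → Bool → ℝ
  lik_nonneg : ∀ e θ x, 0 ≤ lik e θ x
  lik_sum : ∀ e θ, ∑ x, lik e θ x = 1

/-- A partial realization: `ψ e = some x` if test `e` was performed with outcome `x`, and
`ψ e = none` if test `e` was not performed. -/
abbrev PartialRealization (V : Type*) : Type _ := V → Option Bool

/-- A policy picks the next test from the partial realization seen so far; `none` means stop. -/
abbrev Policy (V : Type*) : Type _ := PartialRealization V → Option V

section Policies

variable {V : Type*} [Fintype V] [DecidableEq V]

/-- One step of the policy `σ` when the (complete) outcomes of the tests are given by `φ`.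
Outcomes are persistent, so a test that was already performed reveals nothing new. -/
def Policy.step (σ : Policy V) (φ : V → Bool) (ψ : PartialRealization V) : PartialRealization V :=
  match σ ψ with
  | none => ψ
  | some e => Function.update ψ e (some (φ e))

/-- The partial realization after `ℓ` steps of the policy `σ`, starting from no observation. -/
def Policy.run (σ : Policy V) (φ : V → Bool) (ℓ : ℕ) : PartialRealization V :=
  (σ.step φ)^[ℓ] (fun _ => none)

/-- The partial realization at termination.  Each step either adds a new test or changes nothing
from then on, so `|V|` steps suffice. -/
def Policy.final (σ : Policy V) (φ : V → Bool) : PartialRealization V :=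
  σ.run φ (Fintype.card V)

/-- The number of tests performed in a partial realization. -/
def PartialRealization.size (ψ : PartialRealization V) : ℕ :=
  (Finset.univ.filter fun e => (ψ e).isSome).card

/-- A policy that never stops before all tests are performed and that at every partial realization
picks, among the tests not yet performed, one that maximizes `gain · ψ` (ties broken in any way). -/
def Policy.IsGreedy (gain : V → PartialRealization V → ℝ) (σ : Policy V) : Prop :=
  ∀ ψ : PartialRealization V,
    (∀ e, σ ψ = some e → ψ e = none ∧ ∀ e', ψ e' = none → gain e' ψ ≤ gain e ψ) ∧
    (σ ψ = none → ∀ e, ψ e ≠ none)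

end Policies

noncomputable section

/-- Binary entropy, in bits. -/
def binEntropyBits (p : ℝ) : ℝ := -(p * Real.logb 2 p) - (1 - p) * Real.logb 2 (1 - p)

namespace TestModel

variable {Θ V Y : Type*} [Fintype Θ] [Fintype V] [DecidableEq V] [Fintype Y] [DecidableEq Y]

/-- `ℙ(θ, ψ)`. -/
def joint (M : TestModel Θ V Y) (ψ : PartialRealization V) (θ : Θ) : ℝ :=
  M.prior θ * ∏ e, (ψ e).elim 1 (M.lik e θ)

/-- `ℙ(θ ∣ ψ)`. -/
def posterior (M : TestModel Θ V Y) (ψ : PartialRealization V) (θ : Θ) : ℝ :=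
  M.joint ψ θ / ∑ θ', M.joint ψ θ'

/-- `ℙ(y ∣ ψ)`. -/
def posteriorTarget (M : TestModel Θ V Y) (ψ : PartialRealization V) (y : Y) : ℝ :=
  ∑ θ with M.r θ = y, M.posterior ψ θ

/-- `ℙ(X_e = x ∣ ψ)`, the predictive probability for a test `e` not performed in `ψ`. -/
def predictive (M : TestModel Θ V Y) (ψ : PartialRealization V) (e : V) (x : Bool) : ℝ :=
  ∑ θ, M.posterior ψ θ * M.lik e θ x

/-- The probability that the tests have the outcomes `φ`. -/
def outcomeProb (M : TestModel Θ V Y) (φ : V → Bool) : ℝ :=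
  ∑ θ, M.prior θ * ∏ e, M.lik e θ (φ e)

/-- Expectation over the random outcomes of all tests. -/
def expect (M : TestModel Θ V Y) (g : (V → Bool) → ℝ) : ℝ :=
  ∑ φ, M.outcomeProb φ * g φ

/-- Error probability of the MAP estimator of the target after observing `ψ`. -/
def errMAP (M : TestModel Θ V Y) (ψ : PartialRealization V) : ℝ :=
  1 - ⨆ y, M.posteriorTarget ψ y

/-- Expected error probability after running `σ` until it terminates. -/
def policyErr (M : TestModel Θ V Y) (σ : Policy V) : ℝ :=
  M.expect fun φ => M.errMAP (σ.final φ)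

open Classical in
/-- Worst-case cost: the largest number of tests performed on a path of positive probability. -/
def cost (M : TestModel Θ V Y) (σ : Policy V) : ℕ :=
  (Finset.univ.filter fun φ => 0 < M.outcomeProb φ).sup fun φ => (σ.final φ).size

/-- `σ` has minimal cost among the policies with expected error probability at most `δ`. -/
def IsOptimal (M : TestModel Θ V Y) (δ : ℝ) (σ : Policy V) : Prop :=
  M.policyErr σ ≤ δ ∧ ∀ σ' : Policy V, M.policyErr σ' ≤ δ → M.cost σ ≤ M.cost σ'

/-- The edges: (ordered) pairs of root-causes with different target values. -/
def edges (M : TestModel Θ V Y) : Finset (Θ × Θ) :=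
  Finset.univ.filter fun p => M.r p.1 ≠ M.r p.2

/-- The auxiliary function with parameter `c`. -/
def fAux (M : TestModel Θ V Y) (c : ℝ) (ψ : PartialRealization V) : ℝ :=
  ∑ p ∈ M.edges, M.posterior ψ p.1 * M.posterior ψ p.2 *
      Real.logb 2 (1 / (M.posterior ψ p.1 * M.posterior ψ p.2)) +
    c * ∑ y, binEntropyBits (M.posteriorTarget ψ y)

/-- The expected value of the auxiliary function after `ℓ` steps of `σ`. -/
def fAuxAvg (M : TestModel Θ V Y) (c : ℝ) (σ : Policy V) (ℓ : ℕ) : ℝ :=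
  M.expect fun φ => M.fAux c (σ.run φ ℓ)

/-- The expected MAP error probability after `ℓ` steps of `σ`. -/
def errAvg (M : TestModel Θ V Y) (σ : Policy V) (ℓ : ℕ) : ℝ :=
  M.expect fun φ => M.errMAP (σ.run φ ℓ)

/-- The noise rate of test `e` at the root-cause `θ`. -/
def noiseRate (M : TestModel Θ V Y) (e : V) (θ : Θ) : ℝ := 1 - ⨆ x, M.lik e θ x

/-- The likelihood ratio by which the weight of `θ` is discounted when `e` has outcome `x`. -/
def ratio (M : TestModel Θ V Y) (e : V) (θ : Θ) (x : Bool) : ℝ :=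
  M.lik e θ x / ⨆ x', M.lik e θ x'

/-- The total amount of edge weight discounted by outcome `x` of test `e`. -/
def basicValue (M : TestModel Θ V Y) (ψ : PartialRealization V) (e : V) (x : Bool) : ℝ :=
  ∑ p ∈ M.edges, M.joint ψ p.1 * M.joint ψ p.2 * (1 - M.ratio e p.1 x * M.ratio e p.2 x)

/-- The offset value of outcome `x` of test `e`. -/
def offsetValue (M : TestModel Θ V Y) (ψ : PartialRealization V) (e : V) (x : Bool) : ℝ :=
  ∑ p ∈ M.edges, M.joint ψ p.1 * M.joint ψ p.2 * (1 - ⨆ θ, M.ratio e θ x ^ 2)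

/-- The ECED gain of test `e`: the expected edge weight effectively discounted.  Counting each edge
in both orders only doubles it, which does not matter for its maximizers. -/
def ecedGain (M : TestModel Θ V Y) (e : V) (ψ : PartialRealization V) : ℝ :=
  ∑ x, M.predictive ψ e x * (M.basicValue ψ e x - M.offsetValue ψ e x)

/-- The ECED gain when test `e` has noise rate `ε e` and the expected offset is charged as
`ε (1 - ρ²)` times the total edge weight, where `ρ = ε / (1 - ε)` is the discount factor of
inconsistent root-causes. -/
def ecedGainNoise (M : TestModel Θ V Y) (ε : V → ℝ) (e : V) (ψ : PartialRealization V) : ℝ :=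
  ∑ x, M.predictive ψ e x * M.basicValue ψ e x -
    ε e * (1 - (ε e / (1 - ε e)) ^ 2) * ∑ p ∈ M.edges, M.joint ψ p.1 * M.joint ψ p.2

end TestModel

end

/-! ### Strong concavity of the auxiliary function along a segment (in nats) -/

section Analysis

open Real

/-! Progress at a partial realization is measured by `crossWeight`: the posterior weight of the
edges whose ends get different noise-free outcomes from a test. Two bounds on it are compared.

A test with noise rate `ε` lowers the expected auxiliary function by at least a constant times `(1 -
2ε)²` times its weight (`crossWeight_le_testGain`). The posterior is a mixture, with some parameter
`a`, of two distributions with disjoint supports, one for each noise-free outcome. The test moves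
only this parameter, keeping its mean, so the decrease is a Jensen gap. By
`concaveOn_auxNat_segment` the auxiliary function is at least as concave along this segment as a
multiple of binary entropy. The gap is therefore at least a multiple of the mutual information of a
binary symmetric channel, which is at least `2a(1 - a)(1 - 2ε)²` nats. The term with the large
parameter `c` absorbs the mixed derivatives.

Conversely, `k` tests cannot lower the error by more than `3k` times the largest weight of a test
(`error_decrease_le`). Once the noise pattern is fixed, outcomes are functions of the root-cause and
a policy just refines a partition. Guessing the target from the cell beats the best blind guess by
at most the total edge weight minus the expected edge weight inside the true cell
(`sum_correct_le`), and one refinement removes at most three times the largest weight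
(`survivingWeight_sub_le`).

ECED links the two: up to a noise factor and terms that do not affect the comparison, its gain is
`tripleWeight`, which lies between one and three times `crossWeight`. So its test is nearly the
heaviest available, and `k` times its decrease of the auxiliary function dominates `c_ε` times the
error gap to OPT (`mul_errAvg_sub_policyErr_le`). Finally `fAuxAvg_le` bounds the auxiliary function
by `c_δ` times the error. The inequality comes out without the loss `c_{η,ε}`. -/

lemma concaveOn_half_binEntropy_sub :
    ConcaveOn ℝ (Set.Icc 0 1) fun z : ℝ => binEntropy z / 2 - z * (1 - z) := by
  refine concaveOn_of_hasDerivWithinAt2_nonpos (convex_Icc 0 1)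
    (f' := fun z => (log (1 - z) - log z) / 2 - (1 - 2 * z))
    (f'' := fun z => (-1 / (1 - z) - z⁻¹) / 2 + 2) (by fun_prop) ?_ ?_ ?_
  · rw [interior_Icc]
    rintro z ⟨h0, h1⟩
    refine HasDerivAt.hasDerivWithinAt ?_
    have h := ((hasDerivAt_binEntropy h0.ne' h1.ne).div_const 2).sub
      ((hasDerivAt_id z).mul ((hasDerivAt_id z).const_sub 1))
    refine h.congr_deriv ?_
    simp; ring
  · rw [interior_Icc]
    rintro z ⟨h0, h1⟩
    refine HasDerivAt.hasDerivWithinAt ?_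
    have h := ((((hasDerivAt_id z).const_sub 1).log (sub_pos.2 h1).ne').sub
      (hasDerivAt_log h0.ne')).div_const 2 |>.sub
      (((hasDerivAt_id z).const_mul 2).const_sub 1)
    refine h.congr_deriv ?_
    simp
  · rw [interior_Icc]
    rintro z ⟨h0, h1⟩
    have h1' : 0 < 1 - z := sub_pos.2 h1
    -- The coefficient `1/2` of the entropy is the smallest possible: the second derivative vanishes
    -- at `z = 1/2`.
    have : (-1 / (1 - z) - z⁻¹) / 2 + 2 = -((1 - 2 * z) ^ 2 / (2 * (z * (1 - z)))) := by
      field_simp; ring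
    rw [this]
    have : 0 ≤ (1 - 2 * z) ^ 2 / (2 * (z * (1 - z))) := by positivity
    linarith

lemma mul_log_sq_le_four {q : ℝ} (h0 : 0 < q) (h1 : q ≤ 1) : q * log q ^ 2 ≤ 4 := by
  have h := abs_log_mul_self_rpow_lt q (1 / 2) h0 h1 (by norm_num)
  rw [← sqrt_eq_rpow] at h
  have h2 : |log q * √q| ^ 2 ≤ 2 ^ 2 :=
    pow_le_pow_left₀ (abs_nonneg _) (by norm_num at h ⊢; exact h.le) 2
  rw [sq_abs, mul_pow, sq_sqrt h0.le] at h2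
  linarith

/-- Atoms of mass at least `1/n` have `|log x| ≤ log n`. A lighter atom costs only `O(1/n)` beyond
that, because `q log² q` is bounded at `q = n x`; summed over `n` atoms this is a constant. -/
lemma mul_one_add_log_sq_le {x n : ℝ} (hx0 : 0 ≤ x) (hx1 : x ≤ 1) (hn : 1 ≤ n) :
    x * (1 + log x) ^ 2 ≤ x * (2 * (1 + log n) ^ 2) + 8 / n := by
  have hn0 : 0 < n := by linarith
  have hln : 0 ≤ log n := log_nonneg hn
  rcases hx0.eq_or_lt with rfl | hx
  · simp; positivity
  have hx' := log_nonpos hx0 hx1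
  rcases le_total 1 (n * x) with h | h
  · have h2 := log_nonneg h
    rw [log_mul hn0.ne' hx.ne'] at h2
    have : (1 + log x) ^ 2 ≤ 2 * (1 + log n) ^ 2 := by nlinarith
    have h8 : 0 ≤ 8 / n := by positivity
    nlinarith
  · have h4 := mul_log_sq_le_four (mul_pos hn0 hx) h
    have h2 : log x = log (n * x) - log n := by rw [log_mul hn0.ne' hx.ne']; ring
    have h5 : x * log (n * x) ^ 2 ≤ 4 / n := by
      rw [le_div_iff₀ hn0]; linarith
    have h6 : (1 + log x) ^ 2 ≤ 2 * (1 + log n) ^ 2 + 2 * log (n * x) ^ 2 := by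
      rw [h2]
      nlinarith [sq_nonneg ((1 - log n) + log (n * x)), sq_nonneg ((1 - log n) - log (n * x))]
    have h7 : (8 : ℝ) / n = 2 * (4 / n) := by ring
    nlinarith

lemma sum_mul_one_add_log_sq_le {ι : Type*} {s : Finset ι} {p : ι → ℝ} {n : ℝ} (hn : 1 ≤ n)
    (hcard : (s.card : ℝ) ≤ n) (h0 : ∀ i ∈ s, 0 ≤ p i) (h1 : ∑ i ∈ s, p i ≤ 1) :
    ∑ i ∈ s, p i * (1 + log (p i)) ^ 2 ≤ 2 * (1 + log n) ^ 2 + 8 := by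
  calc ∑ i ∈ s, p i * (1 + log (p i)) ^ 2
      ≤ ∑ i ∈ s, (p i * (2 * (1 + log n) ^ 2) + 8 / n) :=
        Finset.sum_le_sum fun i hi => mul_one_add_log_sq_le (h0 i hi)
          ((Finset.single_le_sum h0 hi).trans h1) hn
    _ = (∑ i ∈ s, p i) * (2 * (1 + log n) ^ 2) + s.card / n * 8 := by
        rw [Finset.sum_add_distrib, Finset.sum_mul, Finset.sum_const, nsmul_eq_mul]; ring
    _ ≤ 1 * (2 * (1 + log n) ^ 2) + 1 * 8 := by
        have : (s.card : ℝ) / n ≤ 1 := by rw [div_le_one (by linarith)]; exact hcard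
        gcongr
    _ = _ := by ring

lemma hasDerivAt_negMulLog_segment {u v z : ℝ} (hu : 0 ≤ u) (hv : 0 ≤ v) (h0 : 0 < z)
    (h1 : z < 1) :
    HasDerivAt (fun z => negMulLog (u * z + v * (1 - z)))
      ((u - v) * (-log (u * z + v * (1 - z)) - 1)) z := by
  have h1' : 0 < 1 - z := sub_pos.2 h1
  have hd : HasDerivAt (fun z => u * z + v * (1 - z)) (u - v) z := by
    have := ((hasDerivAt_id z).const_mul u).add (((hasDerivAt_id z).const_sub 1).const_mul v)
    refine this.congr_deriv ?_
    ring
  -- `negMulLog` is not differentiable at 0, but a zero inside the segment forces `u = v = 0`, and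
  -- then the function is constant.
  by_cases hp : u * z + v * (1 - z) = 0
  · have hu0 : u = 0 := by
      by_contra h
      have := hu.lt_of_ne' h
      have : 0 < u * z := by positivity
      have : 0 ≤ v * (1 - z) := by positivity
      linarith
    have hv0 : v = 0 := by
      by_contra h
      have := hv.lt_of_ne' h
      have : 0 < v * (1 - z) := by positivity
      have : 0 ≤ u * z := by positivity
      linarith
    subst hu0 hv0
    simpa using hasDerivAt_const z (0 : ℝ)
  · refine ((hasDerivAt_negMulLog hp).comp z hd).congr_deriv ?_
    ring

/-- The derivative is `-(u - v)² / (u z + v (1 - z))`; disjoint supports split it into this form,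
which can be summed over a class. -/
lemma hasDerivAt_log_segment {u v z : ℝ} (hu : 0 ≤ u) (hv : 0 ≤ v) (huv : u * v = 0)
    (h0 : 0 < z) (h1 : z < 1) :
    HasDerivAt (fun z => (u - v) * (-log (u * z + v * (1 - z)) - 1)) (-(u / z + v / (1 - z))) z := by
  have h1' : 0 < 1 - z := sub_pos.2 h1
  have hd : HasDerivAt (fun z => u * z + v * (1 - z)) (u - v) z := by
    have := ((hasDerivAt_id z).const_mul u).add (((hasDerivAt_id z).const_sub 1).const_mul v)
    refine this.congr_deriv ?_
    ring
  rcases mul_eq_zero.1 huv with rfl | rfl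
  · rcases hv.eq_or_lt with rfl | hv
    · simpa using hasDerivAt_const z (0 : ℝ)
    · refine (((hd.log (by positivity)).neg.sub_const 1).const_mul (0 - v)).congr_deriv ?_
      field_simp; ring
  · rcases hu.eq_or_lt with rfl | hu
    · simpa using hasDerivAt_const z (0 : ℝ)
    · refine (((hd.log (by positivity)).neg.sub_const 1).const_mul (u - 0)).congr_deriv ?_
      field_simp; ring

/-- Cauchy–Schwarz, using that `u v = 0` factors `(u - v)²`. The slope of the class entropy is thus
controlled by its own curvature. -/
lemma sq_sum_log_le {ι : Type*} {s : Finset ι} {u v : ι → ℝ} {z : ℝ} (hu : ∀ i, 0 ≤ u i)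
    (hv : ∀ i, 0 ≤ v i) (huv : ∀ i, u i * v i = 0) (h0 : 0 < z) (h1 : z < 1) :
    (∑ i ∈ s, (u i - v i) * (-log (u i * z + v i * (1 - z)) - 1)) ^ 2 ≤
      (∑ i ∈ s, (u i / z + v i / (1 - z))) *
        ∑ i ∈ s, (u i * z + v i * (1 - z)) * (1 + log (u i * z + v i * (1 - z))) ^ 2 := by
  have h1' : 0 < 1 - z := sub_pos.2 h1
  refine Finset.sum_sq_le_sum_mul_sum_of_sq_le_mul s (fun i _ => ?_) (fun i _ => ?_)
    (fun i _ => ?_)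
  · have := hu i; have := hv i; positivity
  · have := hu i; have := hv i; positivity
  · have : (u i - v i) ^ 2 = (u i / z + v i / (1 - z)) * (u i * z + v i * (1 - z)) := by
      field_simp
      rcases mul_eq_zero.1 (huv i) with h | h <;> rw [h] <;> ring
    rw [mul_pow, this]
    exact le_of_eq (by ring)

/-- Completing the square in `D`: the curvature of `c` times binary entropy absorbs the mixed term
up to `4 S² P (1 - P) / c`. -/
lemma neg_mul_sub_div_le {c D S P Q : ℝ} (hc : 0 < c) (hP0 : 0 < P) (hP1 : P < 1) (hQ : 0 ≤ Q)
    (hS : 4 * S ^ 2 ≤ c * Q) :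
    -(4 * D * S) - c * (D ^ 2 / (P * (1 - P))) ≤ (1 - P) * Q := by
  have hq : 0 < 1 - P := sub_pos.2 hP1
  have h2 : 0 ≤ (c * D + 2 * S * (P * (1 - P))) ^ 2 / (c * (P * (1 - P))) := by positivity
  have h3 : (c * D + 2 * S * (P * (1 - P))) ^ 2 / (c * (P * (1 - P))) =
      c * (D ^ 2 / (P * (1 - P))) + 4 * D * S + 4 * S ^ 2 * (P * (1 - P)) / c := by
    field_simp; ring
  have h4 : 4 * S ^ 2 * (P * (1 - P)) / c ≤ (1 - P) * Q := by
    rw [div_le_iff₀ hc]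
    calc 4 * S ^ 2 * (P * (1 - P)) ≤ c * Q * (1 * (1 - P)) := by gcongr
      _ = (1 - P) * Q * c := by ring
  linarith

/-- The part of the auxiliary function (in nats) contributed by the root-causes `s` of one target
value, along the segment between two distributions with disjoint supports, is strongly concave. -/
lemma concaveOn_class_segment {ι : Type*} {s : Finset ι} {u v : ι → ℝ} {n c : ℝ}
    (hu : ∀ i, 0 ≤ u i) (hv : ∀ i, 0 ≤ v i) (huv : ∀ i, u i * v i = 0)
    (hA : ∑ i ∈ s, u i ≤ 1) (hB : ∑ i ∈ s, v i ≤ 1) (hn : 1 ≤ n) (hcard : (s.card : ℝ) ≤ n)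
    (hc : 4 * (2 * (1 + log n) ^ 2 + 8) ≤ c) :
    ConcaveOn ℝ (Set.Icc 0 1) fun z =>
      2 * (1 - ((∑ i ∈ s, u i) * z + (∑ i ∈ s, v i) * (1 - z))) *
          ∑ i ∈ s, negMulLog (u i * z + v i * (1 - z)) +
        c * binEntropy ((∑ i ∈ s, u i) * z + (∑ i ∈ s, v i) * (1 - z)) -
        ((∑ i ∈ s, u i) * (1 - ∑ i ∈ s, v i) * (negMulLog z + z ^ 2 / 2) +
          (∑ i ∈ s, v i) * (1 - ∑ i ∈ s, u i) * (negMulLog (1 - z) + (1 - z) ^ 2 / 2)) := by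
  set A := ∑ i ∈ s, u i with hAdef
  set B := ∑ i ∈ s, v i with hBdef
  have hA0 : 0 ≤ A := Finset.sum_nonneg fun i _ => hu i
  have hB0 : 0 ≤ B := Finset.sum_nonneg fun i _ => hv i
  have hc0 : 0 < c := by nlinarith [sq_nonneg (1 + log n)]
  -- If the class mass is 0 at both ends, or 1 at both ends, binary entropy sits at a boundary point
  -- along the whole segment; the expression is then constantly zero.
  by_cases hAB0 : A = 0 ∧ B = 0
  · obtain ⟨ha, hb⟩ := hAB0
    have hu0 : ∀ i ∈ s, u i = 0 := (Finset.sum_eq_zero_iff_of_nonneg fun i _ => hu i).1 ha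
    have hv0 : ∀ i ∈ s, v i = 0 := (Finset.sum_eq_zero_iff_of_nonneg fun i _ => hv i).1 hb
    refine (concaveOn_const (0 : ℝ) (convex_Icc 0 1)).congr fun z _ => ?_
    rw [ha, hb, Finset.sum_eq_zero (fun i hi => by rw [hu0 i hi, hv0 i hi]; simp)]
    simp
  by_cases hAB1 : A = 1 ∧ B = 1
  · obtain ⟨ha, hb⟩ := hAB1
    refine (concaveOn_const (0 : ℝ) (convex_Icc 0 1)).congr fun z _ => ?_
    rw [ha, hb]
    simp
  have hP : ∀ z : ℝ, 0 < z → z < 1 → 0 < A * z + B * (1 - z) ∧ A * z + B * (1 - z) < 1 := by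
    intro z h0 h1
    have h1' : 0 < 1 - z := sub_pos.2 h1
    constructor
    · rcases hA0.eq_or_lt with h | h
      · have : 0 < B := hB0.lt_of_ne fun h' => hAB0 ⟨h.symm, h'.symm⟩
        rw [← h]; simp; positivity
      · positivity
    · rcases hA.eq_or_lt with h | h
      · have : B < 1 := hB.lt_of_ne fun h' => hAB1 ⟨h, h'⟩
        nlinarith
      · nlinarith
  have hd : ∀ z, HasDerivAt (fun z => A * z + B * (1 - z)) (A - B) z := fun z => by
    have := ((hasDerivAt_id z).const_mul A).add (((hasDerivAt_id z).const_sub 1).const_mul B)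
    refine this.congr_deriv ?_
    ring
  refine concaveOn_of_hasDerivWithinAt2_nonpos (convex_Icc 0 1)
    (f' := fun z => -(2 * (A - B)) * ∑ i ∈ s, negMulLog (u i * z + v i * (1 - z)) +
        2 * (1 - (A * z + B * (1 - z))) *
          ∑ i ∈ s, (u i - v i) * (-log (u i * z + v i * (1 - z)) - 1) +
        c * ((log (1 - (A * z + B * (1 - z))) - log (A * z + B * (1 - z))) * (A - B)) -
        (A * (1 - B) * (-log z - 1 + z) + B * (1 - A) * (log (1 - z) + 1 - (1 - z))))
    (f'' := fun z => -(2 * (A - B)) *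
          ∑ i ∈ s, (u i - v i) * (-log (u i * z + v i * (1 - z)) - 1) +
        (-(2 * (A - B)) * ∑ i ∈ s, (u i - v i) * (-log (u i * z + v i * (1 - z)) - 1) +
          2 * (1 - (A * z + B * (1 - z))) * ∑ i ∈ s, -(u i / z + v i / (1 - z))) +
        c * ((-(A - B) / (1 - (A * z + B * (1 - z))) - (A - B) / (A * z + B * (1 - z))) * (A - B)) -
        (A * (1 - B) * (-z⁻¹ + 1) + B * (1 - A) * (-1 / (1 - z) + 1)))
    (by fun_prop) ?_ ?_ ?_
  · rw [interior_Icc]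
    rintro z ⟨h0, h1⟩
    refine HasDerivAt.hasDerivWithinAt ?_
    obtain ⟨hp0, hp1⟩ := hP z h0 h1
    have hS : HasDerivAt (fun z => ∑ i ∈ s, negMulLog (u i * z + v i * (1 - z)))
        (∑ i ∈ s, (u i - v i) * (-log (u i * z + v i * (1 - z)) - 1)) z :=
      HasDerivAt.fun_sum fun i _ => hasDerivAt_negMulLog_segment (hu i) (hv i) h0 h1
    have hH := (hasDerivAt_binEntropy hp0.ne' hp1.ne).comp z (hd z)
    have hg1 : HasDerivAt (fun z : ℝ => negMulLog z + z ^ 2 / 2) (-log z - 1 + z) z := by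
      refine ((hasDerivAt_negMulLog h0.ne').add ((hasDerivAt_pow 2 z).div_const 2)).congr_deriv ?_
      simp
    have hg0 : HasDerivAt (fun z : ℝ => negMulLog (1 - z) + (1 - z) ^ 2 / 2)
        (log (1 - z) + 1 - (1 - z)) z := by
      have h := ((hasDerivAt_negMulLog (sub_pos.2 h1).ne').add
        ((hasDerivAt_pow 2 (1 - z)).div_const 2)).comp z ((hasDerivAt_id z).const_sub 1)
      refine h.congr_deriv ?_
      simp; ring
    refine (((((((hd z).const_sub 1).const_mul 2).mul hS).add (hH.const_mul c)).sub
      ((hg1.const_mul (A * (1 - B))).add (hg0.const_mul (B * (1 - A)))))).congr_deriv ?_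
    ring
  · rw [interior_Icc]
    rintro z ⟨h0, h1⟩
    refine HasDerivAt.hasDerivWithinAt ?_
    obtain ⟨hp0, hp1⟩ := hP z h0 h1
    have hS : HasDerivAt (fun z => ∑ i ∈ s, negMulLog (u i * z + v i * (1 - z)))
        (∑ i ∈ s, (u i - v i) * (-log (u i * z + v i * (1 - z)) - 1)) z :=
      HasDerivAt.fun_sum fun i _ => hasDerivAt_negMulLog_segment (hu i) (hv i) h0 h1
    have hS2 : HasDerivAt
        (fun z => ∑ i ∈ s, (u i - v i) * (-log (u i * z + v i * (1 - z)) - 1))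
        (∑ i ∈ s, -(u i / z + v i / (1 - z))) z :=
      HasDerivAt.fun_sum fun i _ => hasDerivAt_log_segment (hu i) (hv i) (huv i) h0 h1
    have hg1 : HasDerivAt (fun z : ℝ => -log z - 1 + z) (-z⁻¹ + 1) z :=
      ((hasDerivAt_log h0.ne').neg.sub_const 1).add (hasDerivAt_id z)
    have hg0 : HasDerivAt (fun z : ℝ => log (1 - z) + 1 - (1 - z)) (-1 / (1 - z) + 1) z := by
      have h := ((((hasDerivAt_id z).const_sub 1).log (sub_pos.2 h1).ne').add_const 1).sub
        ((hasDerivAt_id z).const_sub 1)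
      refine h.congr_deriv ?_
      simp
    have hl := ((((hd z).const_sub 1).log (sub_pos.2 hp1).ne').sub
      ((hd z).log hp0.ne')).mul_const (A - B)
    exact ((((hS.const_mul (-(2 * (A - B)))).add
      (((((hd z).const_sub 1).const_mul 2).mul hS2).congr_deriv (by ring))).add
      (hl.const_mul c)).sub
      ((hg1.const_mul (A * (1 - B))).add (hg0.const_mul (B * (1 - A)))))
  · rw [interior_Icc]
    rintro z ⟨h0, h1⟩
    obtain ⟨hp0, hp1⟩ := hP z h0 h1
    have h1' : 0 < 1 - z := sub_pos.2 h1
    have hcs := sq_sum_log_le (s := s) hu hv huv h0 h1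
    have hR : ∑ i ∈ s, (u i * z + v i * (1 - z)) * (1 + log (u i * z + v i * (1 - z))) ^ 2 ≤
        2 * (1 + log n) ^ 2 + 8 := by
      refine sum_mul_one_add_log_sq_le hn hcard (fun i _ => ?_) ?_
      · have := hu i; have := hv i; positivity
      · rw [Finset.sum_add_distrib, ← Finset.sum_mul, ← Finset.sum_mul]
        exact hp1.le
    set S := ∑ i ∈ s, (u i - v i) * (-log (u i * z + v i * (1 - z)) - 1)
    set R := ∑ i ∈ s, (u i * z + v i * (1 - z)) * (1 + log (u i * z + v i * (1 - z))) ^ 2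
    have hQ : ∑ i ∈ s, (u i / z + v i / (1 - z)) = A / z + B / (1 - z) := by
      rw [Finset.sum_add_distrib, ← Finset.sum_div, ← Finset.sum_div]
    simp only [Finset.sum_neg_distrib]
    rw [hQ] at hcs ⊢
    set Q := A / z + B / (1 - z) with hQdef
    have hQ0 : 0 ≤ Q := by positivity
    set P := A * z + B * (1 - z) with hPdef
    have hq0 : 0 < 1 - P := sub_pos.2 hp1
    -- Since `1 - P = (1 - A) z + (1 - B)(1 - z)`, the quadratic terms of the comparison function
    -- make it fit, with `A (1 - A) + B (1 - B)` to spare.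
    have hcomp : A * (1 - B) * (z⁻¹ - 1) + B * (1 - A) * (1 / (1 - z) - 1) ≤ (1 - P) * Q := by
      have : (1 - P) * Q - (A * (1 - B) * (z⁻¹ - 1) + B * (1 - A) * (1 / (1 - z) - 1)) =
          (1 - A) * A + (1 - B) * B := by
        rw [hQdef, hPdef]; field_simp; ring
      nlinarith [mul_nonneg (sub_nonneg.2 hA) hA0, mul_nonneg (sub_nonneg.2 hB) hB0]
    have hS : 4 * S ^ 2 ≤ c * Q :=
      calc 4 * S ^ 2 ≤ 4 * (Q * (2 * (1 + log n) ^ 2 + 8)) := by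
            gcongr; exact hcs.trans (by gcongr)
        _ = 4 * (2 * (1 + log n) ^ 2 + 8) * Q := by ring
        _ ≤ c * Q := by gcongr
    -- The class entropy contributes `-2 (1 - P) Q`: one copy of `(1 - P) Q` pays for the mixed
    -- term, the other for `hcomp`.
    have hmain := neg_mul_sub_div_le hc0 hp0 hp1 hQ0 hS (D := A - B)
    have hcc : c * ((-(A - B) / (1 - P) - (A - B) / P) * (A - B)) =
        -(c * ((A - B) ^ 2 / (P * (1 - P)))) := by
      field_simp; ring
    rw [hcc]
    have e1 : -1 / (1 - z) = -(1 / (1 - z)) := by ring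
    rw [e1]
    linarith

end Analysis

/-! ### Elementary entropy inequalities -/

section Entropy

open Real

/-- The difference of the two sides is concave on `[0, 1/2]` and vanishes at both ends. -/
lemma negMulLog_one_sub_le {x : ℝ} (h0 : 0 ≤ x) (h1 : x ≤ 1 / 2) :
    negMulLog (1 - x) ≤ negMulLog x := by
  have hc : ConcaveOn ℝ (Set.Icc (0 : ℝ) (1 / 2)) fun z => negMulLog z - negMulLog (1 - z) := by
    refine concaveOn_of_hasDerivWithinAt2_nonpos (convex_Icc _ _)
      (f' := fun z => (-log z - 1) - (log (1 - z) + 1))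
      (f'' := fun z => -z⁻¹ - -1 / (1 - z)) (by fun_prop) ?_ ?_ ?_
    · rw [interior_Icc]
      rintro z ⟨h0, h1⟩
      refine HasDerivAt.hasDerivWithinAt ?_
      have h1' : 0 < 1 - z := by linarith
      refine ((hasDerivAt_negMulLog h0.ne').sub
        ((hasDerivAt_negMulLog h1'.ne').comp z ((hasDerivAt_id z).const_sub 1))).congr_deriv ?_
      ring
    · rw [interior_Icc]
      rintro z ⟨h0, h1⟩
      refine HasDerivAt.hasDerivWithinAt ?_
      have h1' : 0 < 1 - z := by linarith
      exact ((hasDerivAt_log h0.ne').neg.sub_const 1).sub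
        ((((hasDerivAt_id z).const_sub 1).log h1'.ne').add_const 1)
    · rw [interior_Icc]
      rintro z ⟨h0, h1⟩
      have : (1 - z)⁻¹ ≤ z⁻¹ := inv_anti₀ h0 (by linarith)
      have e : -1 / (1 - z) = -(1 - z)⁻¹ := by ring
      rw [e]; linarith
  have h := hc.2 (show (0 : ℝ) ∈ Set.Icc (0 : ℝ) (1 / 2) by norm_num)
    (show (1 / 2 : ℝ) ∈ Set.Icc (0 : ℝ) (1 / 2) by norm_num)
    (show 0 ≤ 1 - 2 * x by linarith) (show 0 ≤ 2 * x by linarith) (by ring)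
  have e : (1 - 2 * x) • (0 : ℝ) + (2 * x) • (1 / 2 : ℝ) = x := by
    simp only [smul_eq_mul]; ring
  simp only [e] at h
  norm_num at h
  exact h

/-- Gibbs' inequality against mass `P / n` per atom; the total mass `P` need not be one. -/
lemma sum_negMulLog_le {ι : Type*} {s : Finset ι} {p : ι → ℝ} {n : ℝ} (hn : 1 ≤ n)
    (hcard : (s.card : ℝ) ≤ n) (h0 : ∀ i ∈ s, 0 ≤ p i) :
    ∑ i ∈ s, negMulLog (p i) ≤ (∑ i ∈ s, p i) * log n + negMulLog (∑ i ∈ s, p i) := by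
  set P := ∑ i ∈ s, p i with hP
  have hn0 : 0 < n := by linarith
  rcases (Finset.sum_nonneg h0).eq_or_lt with h | h
  · have hz := (Finset.sum_eq_zero_iff_of_nonneg h0).1 h.symm
    rw [hP, ← h, Finset.sum_eq_zero fun i hi => by rw [hz i hi, negMulLog_zero]]
    simp
  · rw [← hP] at h
    have hi : ∀ i ∈ s, negMulLog (p i) ≤ p i * (n / P * negMulLog (P / n) - 1) + P / n := by
      intro i hi
      have e : p i = P / n * (p i * (n / P)) := by field_simp
      have h1 := negMulLog_le_one_sub_self (x := p i * (n / P))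
        (mul_nonneg (h0 i hi) (by positivity))
      have h2 : P / n * negMulLog (p i * (n / P)) ≤ P / n * (1 - p i * (n / P)) := by gcongr
      have e2 : negMulLog (p i) =
          p i * (n / P) * negMulLog (P / n) + P / n * negMulLog (p i * (n / P)) := by
        conv_lhs => rw [e]
        rw [negMulLog_mul]
      have e3 : P / n * (1 - p i * (n / P)) = P / n - p i := by field_simp
      rw [e2]; linarith
    refine (Finset.sum_le_sum hi).trans ?_
    rw [Finset.sum_add_distrib, ← Finset.sum_mul, Finset.sum_const, nsmul_eq_mul, ← hP]
    have e4 : P * (n / P * negMulLog (P / n) - 1) = P * log n + negMulLog P - P := by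
      rw [negMulLog, negMulLog, log_div h.ne' hn0.ne']; field_simp; ring
    have e5 : (s.card : ℝ) * (P / n) ≤ P := by
      rw [mul_div_assoc', div_le_iff₀ hn0]; nlinarith
    linarith

lemma negMulLog_sum_le {ι : Type*} {s : Finset ι} {p : ι → ℝ} (h0 : ∀ i ∈ s, 0 ≤ p i) :
    negMulLog (∑ i ∈ s, p i) ≤ ∑ i ∈ s, negMulLog (p i) := by
  rw [negMulLog, neg_mul, Finset.sum_mul, ← Finset.sum_neg_distrib]
  refine Finset.sum_le_sum fun i hi => ?_
  rcases (h0 i hi).eq_or_lt with h | h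
  · rw [← h]; simp
  · have h2 : p i ≤ ∑ i ∈ s, p i := Finset.single_le_sum h0 hi
    have := log_le_log h h2
    rw [negMulLog]; nlinarith

/-- The only delicate term is `negMulLog (1 - x)`: below `1/2` it is at most `negMulLog x`, and
above `1/2` the bound `1 - x ≥ 1/n` gives at most `x log n`. Then `-log x ≤ -log δ`. -/
lemma binEntropy_add_mul_log_le {x δ n : ℝ} (hδ : 0 < δ) (hδx : δ ≤ x) (hn : 1 ≤ n)
    (hx : x ≤ 1 - 1 / n) : binEntropy x + x * log n ≤ 2 * (x * log (n / δ)) := by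
  have hn0 : 0 < n := by linarith
  have hx0 : 0 < x := hδ.trans_le hδx
  have hx1 : 0 < 1 - x := by have : 0 < 1 / n := by positivity
                             linarith
  have hln := log_nonneg hn
  have h1 : log n - log x ≤ log (n / δ) := by
    rw [log_div hn0.ne' hδ.ne']
    linarith [log_le_log hδ hδx]
  have h2 : negMulLog (1 - x) ≤ x * log n - x * log x := by
    have hlx : log x ≤ 0 := log_nonpos hx0.le (by linarith)
    rcases le_total x (1 / 2) with h | h
    · have := negMulLog_one_sub_le hx0.le h
      have h3 : negMulLog x = -(x * log x) := by rw [negMulLog]; ring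
      nlinarith
    · have h4 : -log n ≤ log (1 - x) := by
        rw [← log_inv]
        refine log_le_log (by positivity) ?_
        rw [← one_div]; linarith
      have h5 : log (1 - x) ≤ 0 := log_nonpos hx1.le (by linarith)
      rw [negMulLog]
      nlinarith
  rw [binEntropy_eq_negMulLog_add_negMulLog_one_sub]
  have h3 : negMulLog x = -(x * log x) := by rw [negMulLog]; ring
  nlinarith

end Entropy

/-! ### Upper bound on the auxiliary function by the MAP error -/

noncomputable section

open Real

variable {Θ Y : Type*} [Fintype Θ] [DecidableEq Y]

/-- The mass of the target value `y` under the distribution `p` of the root-cause. -/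
def targetMass (r : Θ → Y) (p : Θ → ℝ) (y : Y) : ℝ := ∑ θ with r θ = y, p θ

/-- The weight of the edges whose ends are separated by the noise-free outcomes `ty`. -/
def crossWeight (r : Θ → Y) (p : Θ → ℝ) (ty : Θ → Bool) : ℝ :=
  ∑ θ, ∑ θ', if r θ ≠ r θ' ∧ ty θ ≠ ty θ' then p θ * p θ' else 0

lemma targetMass_nonneg {r : Θ → Y} {p : Θ → ℝ} (h : ∀ θ, 0 ≤ p θ) (y : Y) :
    0 ≤ targetMass r p y := Finset.sum_nonneg fun θ _ => h θ

lemma targetMass_le_one {r : Θ → Y} {p : Θ → ℝ} (h : ∀ θ, 0 ≤ p θ) (h1 : ∑ θ, p θ = 1) (y : Y) :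
    targetMass r p y ≤ 1 := by
  rw [← h1]
  exact Finset.sum_le_sum_of_subset_of_nonneg (Finset.subset_univ _) fun θ _ _ => h θ

lemma card_filter_le_card (r : Θ → Y) (y : Y) :
    (((Finset.univ.filter fun θ => r θ = y).card : ℕ) : ℝ) ≤ Fintype.card Θ := by
  exact_mod_cast Finset.card_le_univ _

variable [Fintype Y]

/-- The auxiliary function of a distribution of the root-cause, in nats. -/
def auxNat (r : Θ → Y) (c : ℝ) (p : Θ → ℝ) : ℝ :=
  ∑ y, (2 * (1 - targetMass r p y) * ∑ θ with r θ = y, negMulLog (p θ) +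
    c * binEntropy (targetMass r p y))

lemma sum_targetMass (r : Θ → Y) (p : Θ → ℝ) : ∑ y, targetMass r p y = ∑ θ, p θ :=
  Finset.sum_fiberwise _ _ _

lemma targetMass_add_le_one {r : Θ → Y} {p : Θ → ℝ} (h : ∀ θ, 0 ≤ p θ) (h1 : ∑ θ, p θ = 1)
    {y z : Y} (hyz : y ≠ z) : targetMass r p y + targetMass r p z ≤ 1 := by
  rw [← h1, ← sum_targetMass r p, ← Finset.sum_pair hyz]
  exact Finset.sum_le_sum_of_subset_of_nonneg (Finset.subset_univ _)
    fun y _ _ => targetMass_nonneg h y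

lemma sum_erase_negMulLog_le {r : Θ → Y} {p : Θ → ℝ} (h : ∀ θ, 0 ≤ p θ) (h1 : ∑ θ, p θ = 1)
    (z : Y) :
    ∑ y ∈ Finset.univ.erase z, ∑ θ with r θ = y, negMulLog (p θ) ≤
      (1 - targetMass r p z) * log (Fintype.card Θ) + negMulLog (1 - targetMass r p z) := by
  have hne : Nonempty Θ := by
    by_contra hcon
    rw [not_nonempty_iff] at hcon
    simp at h1
  have key : ∀ f : Θ → ℝ, ∑ y ∈ Finset.univ.erase z, ∑ θ with r θ = y, f θ =
      ∑ θ with r θ ≠ z, f θ := by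
    intro f
    have e1 := Finset.sum_erase_add Finset.univ (fun y => ∑ θ with r θ = y, f θ)
      (Finset.mem_univ z)
    rw [Finset.sum_fiberwise, ← Finset.sum_filter_add_sum_filter_not Finset.univ (fun θ => r θ = z)]
      at e1
    linarith
  have e2 : ∑ θ with r θ ≠ z, p θ = 1 - targetMass r p z := by
    rw [← key]
    have e1 := Finset.sum_erase_add Finset.univ (fun y => ∑ θ with r θ = y, p θ)
      (Finset.mem_univ z)
    rw [Finset.sum_fiberwise, h1] at e1
    rw [targetMass]; linarith
  rw [key, ← e2]
  refine sum_negMulLog_le ?_ ?_ fun θ _ => h θ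
  · exact_mod_cast Fintype.card_pos
  · exact_mod_cast Finset.card_le_univ _

/-- All classes except the heaviest are charged to the entropy of their root-causes, whose total
mass is just the MAP error. In the heaviest class the factor `1 - targetMass r p z` is itself the
error. -/
lemma auxNat_le {r : Θ → Y} {c : ℝ} (hc : 0 ≤ c) {p : Θ → ℝ} (h : ∀ θ, 0 ≤ p θ)
    (h1 : ∑ θ, p θ = 1) {z : Y} (hz : ∀ y, targetMass r p y ≤ targetMass r p z) :
    auxNat r c p ≤ (3 * c + 4) * (binEntropy (1 - targetMass r p z) +
      (1 - targetMass r p z) * log (Fintype.card Θ)) := by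
  have hne : Nonempty Θ := by
    by_contra hcon
    rw [not_nonempty_iff] at hcon
    simp at h1
  have hn : (1 : ℝ) ≤ Fintype.card Θ := by exact_mod_cast Fintype.card_pos
  have hln := log_nonneg hn
  have hE := sum_erase_negMulLog_le h h1 (r := r) z
  have hZ := sum_negMulLog_le hn (card_filter_le_card r z) fun θ _ => h θ
  have hm0 := targetMass_nonneg h (r := r) z
  have hm1 := targetMass_le_one h h1 (r := r) z
  change _ ≤ targetMass r p z * _ + negMulLog (targetMass r p z) at hZ
  have hnm := negMulLog_nonneg hm0 hm1
  have hne' := negMulLog_nonneg (x := 1 - targetMass r p z) (by linarith) (by linarith)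
  have hS0 : ∀ y, 0 ≤ ∑ θ with r θ = y, negMulLog (p θ) := fun y =>
    Finset.sum_nonneg fun θ _ => negMulLog_nonneg (h θ)
      (h1 ▸ Finset.single_le_sum (fun i _ => h i) (Finset.mem_univ θ))
  have hb : binEntropy (1 - targetMass r p z) =
      negMulLog (1 - targetMass r p z) + negMulLog (targetMass r p z) := by
    rw [binEntropy_eq_negMulLog_add_negMulLog_one_sub, sub_sub_cancel]
  rw [auxNat, ← Finset.sum_erase_add _ _ (Finset.mem_univ z)]
  have hrest : ∀ y ∈ Finset.univ.erase z,
      2 * (1 - targetMass r p y) * ∑ θ with r θ = y, negMulLog (p θ) +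
        c * binEntropy (targetMass r p y) ≤
      (2 + 2 * c) * ∑ θ with r θ = y, negMulLog (p θ) := by
    intro y hy
    have hyz := Finset.ne_of_mem_erase hy
    have ha := targetMass_add_le_one h h1 (r := r) hyz
    have hb0 := targetMass_nonneg h (r := r) y
    have hsub : negMulLog (targetMass r p y) ≤ ∑ θ with r θ = y, negMulLog (p θ) :=
      negMulLog_sum_le fun θ _ => h θ
    -- A class other than the heaviest has mass at most `1/2`.
    have hhalf := negMulLog_one_sub_le hb0 (by linarith [hz y])
    have hbe : binEntropy (targetMass r p y) ≤ 2 * ∑ θ with r θ = y, negMulLog (p θ) := by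
      rw [binEntropy_eq_negMulLog_add_negMulLog_one_sub]; linarith
    have h5 := mul_le_mul_of_nonneg_left hbe hc
    have h6 := mul_nonneg hb0 (hS0 y)
    linarith
  have h2 := Finset.sum_le_sum hrest
  rw [← Finset.mul_sum] at h2
  have h3 := mul_le_mul_of_nonneg_left hE (show (0 : ℝ) ≤ 2 + 2 * c by linarith)
  have hbz : binEntropy (targetMass r p z) = binEntropy (1 - targetMass r p z) :=
    (binEntropy_one_sub _).symm
  rw [hbz, hb]
  set m := targetMass r p z
  set e := negMulLog (1 - m)
  set l := log (Fintype.card Θ)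
  set S := ∑ θ with r θ = z, negMulLog (p θ)
  have h4 : 2 * (1 - m) * S ≤ 2 * (1 - m) * (m * l + negMulLog m) := by
    have : 0 ≤ 1 - m := by linarith
    gcongr
  have h5 : 2 * (1 - m) * (m * l) ≤ 2 * (1 - m) * (1 * l) := by
    have : 0 ≤ 1 - m := by linarith
    gcongr
  have h6 : 2 * (1 - m) * negMulLog m ≤ 2 * 1 * negMulLog m := by
    gcongr; linarith
  have h7 : 0 ≤ c * ((1 - m) * l) := by
    have : 0 ≤ 1 - m := by linarith
    positivity
  have h8 : 0 ≤ c * negMulLog m := by positivity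
  linarith

end

/-! ### Decrease of the auxiliary function by one noisy test -/

noncomputable section

open Real

/-- Likelihood of outcome `x` for a test with noise rate `ε` and noise-free outcome `t`. -/
def flipLik (ε : ℝ) (t x : Bool) : ℝ := if x = t then 1 - ε else ε

/-- Concavity of `H/2 - z(1 - z)` between `ε` and `1 - ε`: the quadratic part grows by exactly `a(1
- a)(1 - 2ε)²`. -/
lemma binEntropy_flip_sub_le {ε a : ℝ} (hε0 : 0 ≤ ε) (hε1 : ε ≤ 1) (ha0 : 0 ≤ a) (ha1 : a ≤ 1) :
    2 * (a * (1 - a)) * (1 - 2 * ε) ^ 2 ≤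
      binEntropy (a * (1 - ε) + (1 - a) * ε) - binEntropy ε := by
  have h := concaveOn_half_binEntropy_sub.2
    (show 1 - ε ∈ Set.Icc (0 : ℝ) 1 from ⟨by linarith, by linarith⟩)
    (show ε ∈ Set.Icc (0 : ℝ) 1 from ⟨hε0, hε1⟩) ha0 (sub_nonneg.2 ha1) (by ring)
  simp only [smul_eq_mul, binEntropy_one_sub] at h
  nlinarith

/-- The chain rule for the entropy of a binary variable observed through a binary symmetric
channel. -/
lemma binEntropy_posterior_eq {ε a q₁ q₀ : ℝ} (h1 : q₁ = a * (1 - ε) + (1 - a) * ε)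
    (h0 : q₀ = a * ε + (1 - a) * (1 - ε)) (hq1 : 0 < q₁) (hq0 : 0 < q₀) :
    q₁ * binEntropy (a * (1 - ε) / q₁) + q₀ * binEntropy (a * ε / q₀) =
      binEntropy a + binEntropy ε - binEntropy q₁ := by
  have key : ∀ q x y : ℝ, 0 < q → q = x + y →
      q * binEntropy (x / q) = negMulLog x + negMulLog y - negMulLog q := by
    intro q x y hq hxy
    have e : 1 - x / q = y / q := by field_simp; linarith
    have hx := negMulLog_mul (x / q) q
    have hy := negMulLog_mul (y / q) q
    rw [div_mul_cancel₀ _ hq.ne'] at hx hy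
    rw [binEntropy_eq_negMulLog_add_negMulLog_one_sub, e, hx, hy]
    field_simp
    rw [hxy]; ring
  rw [key _ _ _ hq1 h1, key _ _ _ hq0 h0]
  simp only [negMulLog_mul, binEntropy_eq_negMulLog_add_negMulLog_one_sub]
  have : q₀ = 1 - q₁ := by rw [h0, h1]; ring
  rw [this]; ring

variable {Θ Y : Type*} [Fintype Θ] [DecidableEq Y]

lemma targetMass_segment (r : Θ → Y) (u v : Θ → ℝ) (z : ℝ) (y : Y) :
    targetMass r (fun θ => u θ * z + v θ * (1 - z)) y =
      targetMass r u y * z + targetMass r v y * (1 - z) := by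
  simp only [targetMass, Finset.sum_add_distrib, Finset.sum_mul]

variable [Fintype Y]

lemma concaveOn_auxNat_segment {r : Θ → Y} {c : ℝ} {u v : Θ → ℝ}
    (hu : ∀ θ, 0 ≤ u θ) (hv : ∀ θ, 0 ≤ v θ) (huv : ∀ θ, u θ * v θ = 0)
    (hu1 : ∑ θ, u θ = 1) (hv1 : ∑ θ, v θ = 1)
    (hc : 4 * (2 * (1 + log (Fintype.card Θ)) ^ 2 + 8) ≤ c) :
    ConcaveOn ℝ (Set.Icc 0 1) fun z => auxNat r c (fun θ => u θ * z + v θ * (1 - z)) -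
      (∑ y, targetMass r u y * (1 - targetMass r v y)) * (binEntropy z / 2) := by
  have hne : Nonempty Θ := by
    by_contra hcon
    rw [not_nonempty_iff] at hcon
    simp at hu1
  have hn : (1 : ℝ) ≤ Fintype.card Θ := by exact_mod_cast Fintype.card_pos
  set X := ∑ y, targetMass r u y * (1 - targetMass r v y) with hX
  have hX0 : 0 ≤ X := Finset.sum_nonneg fun y _ =>
    mul_nonneg (targetMass_nonneg hu y) (sub_nonneg.2 (targetMass_le_one hv hv1 y))
  have hX' : ∑ y, targetMass r v y * (1 - targetMass r u y) = X := by
    rw [hX]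
    simp only [mul_sub, mul_one, Finset.sum_sub_distrib, sum_targetMass, hu1, hv1]
    congr 1
    exact Finset.sum_congr rfl fun y _ => mul_comm _ _
  have h1 := Finset.sum_induction (s := (Finset.univ : Finset Y)) (fun y => fun z : ℝ =>
      2 * (1 - (targetMass r u y * z + targetMass r v y * (1 - z))) *
          ∑ θ with r θ = y, negMulLog (u θ * z + v θ * (1 - z)) +
        c * binEntropy (targetMass r u y * z + targetMass r v y * (1 - z)) -
        (targetMass r u y * (1 - targetMass r v y) * (negMulLog z + z ^ 2 / 2) +
          targetMass r v y * (1 - targetMass r u y) * (negMulLog (1 - z) + (1 - z) ^ 2 / 2)))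
    (ConcaveOn ℝ (Set.Icc (0 : ℝ) 1)) (fun _ _ h h' => h.add h')
    (concaveOn_const 0 (convex_Icc 0 1))
    (fun y _ => concaveOn_class_segment hu hv huv (targetMass_le_one hu hu1 y)
      (targetMass_le_one hv hv1 y) hn (card_filter_le_card r y) hc)
  -- As `(z² + (1 - z)²)/2 = 1/2 - z(1 - z)`, adding this concave multiple of `X` cancels the
  -- quadratic terms and half of the entropy.
  have h2 := (h1.add (concaveOn_half_binEntropy_sub.smul hX0)).add
    (concaveOn_const (X / 2) (convex_Icc (0 : ℝ) 1))
  refine h2.congr fun z _ => ?_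
  simp only [Pi.add_apply, Finset.sum_apply, smul_eq_mul, auxNat, targetMass_segment]
  rw [Finset.sum_sub_distrib, Finset.sum_add_distrib (f := fun y =>
    targetMass r u y * (1 - targetMass r v y) * (negMulLog z + z ^ 2 / 2)), ← Finset.sum_mul,
    ← Finset.sum_mul, hX', ← hX, binEntropy_eq_negMulLog_add_negMulLog_one_sub]
  ring

/-- Performing a test with noise rate `ε` decreases the auxiliary function in expectation. -/
lemma crossWeight_le_auxNat_sub {r : Θ → Y} {c ε : ℝ} {p : Θ → ℝ} (h : ∀ θ, 0 ≤ p θ)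
    (h1 : ∑ θ, p θ = 1) (ty : Θ → Bool) (hε0 : 0 ≤ ε) (hε1 : ε ≤ 1 / 2)
    (hc : 4 * (2 * (1 + log (Fintype.card Θ)) ^ 2 + 8) ≤ c) :
    (1 - 2 * ε) ^ 2 / 2 * crossWeight r p ty ≤ auxNat r c p -
      ∑ x, (∑ θ, p θ * flipLik ε (ty θ) x) *
        auxNat r c (fun θ => p θ * flipLik ε (ty θ) x / ∑ θ, p θ * flipLik ε (ty θ) x) := by
  -- If one noise-free outcome has all the mass, one end of the segment is undefined; but then the
  -- test does not change the posterior and separates nothing.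
  by_cases hdeg : ∃ t, ∀ θ, p θ ≠ 0 → ty θ = t
  · obtain ⟨t, ht⟩ := hdeg
    have hcw : crossWeight r p ty = 0 := by
      refine Finset.sum_eq_zero fun θ _ => Finset.sum_eq_zero fun θ' _ => ?_
      split_ifs with hcond
      · by_contra hne
        exact hcond.2 ((ht θ (left_ne_zero_of_mul hne)).trans
          (ht θ' (right_ne_zero_of_mul hne)).symm)
      · rfl
    have hp : ∀ x θ, p θ * flipLik ε (ty θ) x = p θ * flipLik ε t x := by
      intro x θ
      by_cases h0 : p θ = 0
      · simp [h0]
      · rw [ht θ h0]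
    have hterm : ∀ x, (∑ θ, p θ * flipLik ε (ty θ) x) *
        auxNat r c (fun θ => p θ * flipLik ε (ty θ) x / ∑ θ, p θ * flipLik ε (ty θ) x) =
        flipLik ε t x * auxNat r c p := by
      intro x
      simp only [hp, ← Finset.sum_mul, h1, one_mul]
      by_cases hx : flipLik ε t x = 0
      · simp [hx]
      · simp only [mul_div_cancel_right₀ _ hx]
    have hs : ∑ x, flipLik ε t x = 1 := by cases t <;> simp [flipLik]
    rw [hcw, Finset.sum_congr rfl fun x _ => hterm x, ← Finset.sum_mul, hs]
    simp
  push Not at hdeg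
  set a := ∑ θ, if ty θ = true then p θ else 0 with ha
  have hb : ∑ θ, (if ty θ = true then 0 else p θ) = 1 - a := by
    rw [ha, ← h1, ← Finset.sum_sub_distrib]
    refine Finset.sum_congr rfl fun θ _ => ?_
    split_ifs <;> simp
  have ha0 : 0 < a := by
    obtain ⟨θ, h0, hθ⟩ := hdeg false
    refine Finset.sum_pos' (fun θ _ => ?_) ⟨θ, Finset.mem_univ θ, ?_⟩
    · split_ifs <;> simp [h]
    · rw [if_pos (by simpa using hθ)]
      exact (h θ).lt_of_ne' h0
  have hb0 : 0 < 1 - a := by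
    rw [← hb]
    obtain ⟨θ, h0, hθ⟩ := hdeg true
    refine Finset.sum_pos' (fun θ _ => ?_) ⟨θ, Finset.mem_univ θ, ?_⟩
    · split_ifs <;> simp [h]
    · rw [if_neg hθ]
      exact (h θ).lt_of_ne' h0
  set u : Θ → ℝ := fun θ => (if ty θ = true then p θ else 0) / a with hu
  set v : Θ → ℝ := fun θ => (if ty θ = true then 0 else p θ) / (1 - a) with hv
  have hu0 : ∀ θ, 0 ≤ u θ := fun θ => div_nonneg (by split_ifs <;> simp [h]) ha0.le
  have hv0 : ∀ θ, 0 ≤ v θ := fun θ => div_nonneg (by split_ifs <;> simp [h]) hb0.le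
  have huv : ∀ θ, u θ * v θ = 0 := fun θ => by simp only [hu, hv]; split_ifs <;> simp
  have hu1 : ∑ θ, u θ = 1 := by rw [← Finset.sum_div, ← ha, div_self ha0.ne']
  have hv1 : ∑ θ, v θ = 1 := by rw [← Finset.sum_div, hb, div_self hb0.ne']
  have hconc := concaveOn_auxNat_segment (r := r) hu0 hv0 huv hu1 hv1 hc
  set X := ∑ y, targetMass r u y * (1 - targetMass r v y) with hX
  have hX0 : 0 ≤ X := Finset.sum_nonneg fun y _ =>
    mul_nonneg (targetMass_nonneg hu0 y) (sub_nonneg.2 (targetMass_le_one hv0 hv1 y))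
  have hpu : ∀ θ, (if ty θ = true then p θ else 0) = a * u θ := fun θ => by
    simp only [hu]; field_simp
  have hpv : ∀ θ, (if ty θ = true then 0 else p θ) = (1 - a) * v θ := fun θ => by
    simp only [hv]; field_simp
  have hXuv : ∑ θ, ∑ θ', (if r θ ≠ r θ' then u θ * v θ' else 0) = X := by
    rw [hX, ← Finset.sum_fiberwise Finset.univ r]
    refine Finset.sum_congr rfl fun y _ => ?_
    rw [targetMass, Finset.sum_mul]
    refine Finset.sum_congr rfl fun θ hθ => ?_
    have e : 1 - targetMass r v y = ∑ θ', if y ≠ r θ' then v θ' else 0 := by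
      rw [targetMass, ← hv1, Finset.sum_filter, ← Finset.sum_sub_distrib]
      refine Finset.sum_congr rfl fun θ' _ => ?_
      by_cases hy : r θ' = y
      · simp [hy]
      · simp [hy, Ne.symm hy]
    rw [(Finset.mem_filter.1 hθ).2, e, Finset.mul_sum]
    exact Finset.sum_congr rfl fun θ' _ => by rw [mul_ite, mul_zero]
  -- Edges are ordered pairs, so each direction contributes `a (1 - a) X`.
  have hcw : crossWeight r p ty = 2 * (a * (1 - a)) * X := by
    have hsym : ∑ θ, ∑ θ', (if r θ ≠ r θ' then v θ * u θ' else 0) = X := by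
      rw [← hXuv, Finset.sum_comm]
      refine Finset.sum_congr rfl fun θ _ => Finset.sum_congr rfl fun θ' _ => ?_
      rw [mul_comm]
      simp only [ne_eq, eq_comm]
    have : crossWeight r p ty = a * (1 - a) * (∑ θ, ∑ θ', (if r θ ≠ r θ' then u θ * v θ' else 0)) +
        a * (1 - a) * (∑ θ, ∑ θ', (if r θ ≠ r θ' then v θ * u θ' else 0)) := by
      rw [crossWeight, Finset.mul_sum, Finset.mul_sum, ← Finset.sum_add_distrib]
      refine Finset.sum_congr rfl fun θ _ => ?_
      rw [Finset.mul_sum, Finset.mul_sum, ← Finset.sum_add_distrib]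
      refine Finset.sum_congr rfl fun θ' _ => ?_
      by_cases hr : r θ = r θ'
      · simp [hr]
      · have e : (a * u θ) * ((1 - a) * v θ') + ((1 - a) * v θ) * (a * u θ') =
            if ty θ ≠ ty θ' then p θ * p θ' else 0 := by
          rw [← hpu, ← hpu, ← hpv, ← hpv]
          cases ty θ <;> cases ty θ' <;> simp
        simp only [ne_eq, hr, not_false_eq_true, true_and, if_true]
        simp only [ne_eq] at e
        rw [← e]; ring
    rw [this, hXuv, hsym]; ring
  set q₁ := a * (1 - ε) + (1 - a) * ε with hq₁
  set q₀ := a * ε + (1 - a) * (1 - ε) with hq₀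
  have hε' : 0 < 1 - ε := by linarith
  have hq1 : 0 < q₁ := by positivity
  have hq0 : 0 < q₀ := by positivity
  have hps : ∀ θ, p θ = a * u θ + (1 - a) * v θ := fun θ => by
    rw [← hpu, ← hpv]; split_ifs <;> simp
  have hL1 : ∀ θ, p θ * flipLik ε (ty θ) true = a * u θ * (1 - ε) + (1 - a) * v θ * ε := fun θ => by
    rw [← hpu, ← hpv, flipLik]; cases ty θ <;> simp
  have hL0 : ∀ θ, p θ * flipLik ε (ty θ) false = a * u θ * ε + (1 - a) * v θ * (1 - ε) :=
    fun θ => by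
      rw [← hpu, ← hpv, flipLik]; cases ty θ <;> simp
  have hs1 : ∑ θ, (a * u θ * (1 - ε) + (1 - a) * v θ * ε) = q₁ := by
    rw [Finset.sum_add_distrib, ← Finset.sum_mul, ← Finset.sum_mul, ← Finset.mul_sum,
      ← Finset.mul_sum, hu1, hv1]; ring
  have hs0 : ∑ θ, (a * u θ * ε + (1 - a) * v θ * (1 - ε)) = q₀ := by
    rw [Finset.sum_add_distrib, ← Finset.sum_mul, ← Finset.sum_mul, ← Finset.mul_sum,
      ← Finset.mul_sum, hu1, hv1]; ring
  rw [Fintype.sum_bool]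
  simp only [hL1, hL0, hs1, hs0]
  have hf : auxNat r c p = auxNat r c (fun θ => u θ * a + v θ * (1 - a)) := by
    congr 1; funext θ; rw [hps]; ring
  have hf1 : (fun θ => (a * u θ * (1 - ε) + (1 - a) * v θ * ε) / q₁) =
      fun θ => u θ * (a * (1 - ε) / q₁) + v θ * (1 - a * (1 - ε) / q₁) := by
    funext θ
    have : 1 - a * (1 - ε) / q₁ = (1 - a) * ε / q₁ := by field_simp; rw [hq₁]; ring
    rw [this]; ring
  have hf0 : (fun θ => (a * u θ * ε + (1 - a) * v θ * (1 - ε)) / q₀) =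
      fun θ => u θ * (a * ε / q₀) + v θ * (1 - a * ε / q₀) := by
    funext θ
    have : 1 - a * ε / q₀ = (1 - a) * (1 - ε) / q₀ := by field_simp; rw [hq₀]; ring
    rw [this]; ring
  rw [hf, hf1, hf0, hcw]
  have hτ1 : a * (1 - ε) / q₁ ∈ Set.Icc (0 : ℝ) 1 :=
    ⟨by positivity, by rw [div_le_one hq1, hq₁]; linarith [mul_nonneg hb0.le hε0]⟩
  have hτ0 : a * ε / q₀ ∈ Set.Icc (0 : ℝ) 1 :=
    ⟨by positivity, by rw [div_le_one hq0, hq₀]; linarith [mul_nonneg hb0.le hε'.le]⟩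
  -- Bayes' rule moves the parameter `a` to these two values, with mean `a`. The gap of `H/2` is
  -- half the mutual information `H(q₁) - H(ε)`, by the chain rule.
  have hJ := hconc.2 hτ1 hτ0 hq1.le hq0.le (by rw [hq₁, hq₀]; ring)
  have hmean : q₁ • (a * (1 - ε) / q₁) + q₀ • (a * ε / q₀) = a := by
    simp only [smul_eq_mul]; field_simp; ring
  rw [hmean] at hJ
  simp only [smul_eq_mul] at hJ
  have hH := binEntropy_posterior_eq hq₁ hq₀ hq1 hq0
  have hP := binEntropy_flip_sub_le hε0 (by linarith) ha0.le (by linarith : a ≤ 1)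
  rw [← hq₁] at hP
  have hXP := mul_le_mul_of_nonneg_left hP hX0
  have hXH : X * (q₁ * binEntropy (a * (1 - ε) / q₁) + q₀ * binEntropy (a * ε / q₀)) =
      X * (binEntropy a + binEntropy ε - binEntropy q₁) := by rw [hH]
  linarith

end

/-! ### Runs of policies and the outcomes compatible with them -/

section Compat

variable {V : Type*} [DecidableEq V]

lemma Policy.step_of_none {σ : Policy V} {φ : V → Bool} {ψ : PartialRealization V}
    (h : σ ψ = none) : σ.step φ ψ = ψ := by
  simp [Policy.step, h]

lemma Policy.step_of_some {σ : Policy V} {φ : V → Bool} {ψ : PartialRealization V} {e : V}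
    (h : σ ψ = some e) : σ.step φ ψ = Function.update ψ e (some (φ e)) := by
  simp [Policy.step, h]

lemma Policy.run_succ (σ : Policy V) (φ : V → Bool) (ℓ : ℕ) :
    σ.run φ (ℓ + 1) = σ.step φ (σ.run φ ℓ) := Function.iterate_succ_apply' _ _ _

variable [Fintype V]

/-- The complete outcomes that agree with a partial realization. -/
def PartialRealization.compat (ψ : PartialRealization V) : Finset (V → Bool) :=
  Fintype.piFinset fun e => (ψ e).elim Finset.univ fun x => {x}

lemma PartialRealization.mem_compat {ψ : PartialRealization V} {φ : V → Bool} :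
    φ ∈ ψ.compat ↔ ∀ e x, ψ e = some x → φ e = x := by
  rw [PartialRealization.compat, Fintype.mem_piFinset]
  refine forall_congr' fun e => ?_
  cases ψ e <;> simp

lemma PartialRealization.mem_compat_update {ψ : PartialRealization V} {e : V} (he : ψ e = none)
    {x : Bool} {φ : V → Bool} :
    φ ∈ PartialRealization.compat (Function.update ψ e (some x)) ↔ φ ∈ ψ.compat ∧ φ e = x := by
  simp only [PartialRealization.mem_compat]
  constructor
  · intro h
    refine ⟨fun e' x' h' => h e' x' ?_, h e x (by simp)⟩
    rw [Function.update_of_ne (by rintro rfl; simp [he] at h'), h']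
  · rintro ⟨h, h'⟩ e' x' hx
    by_cases hee : e' = e
    · subst hee
      rw [Function.update_self] at hx
      simpa [h'] using hx
    · rw [Function.update_of_ne hee] at hx
      exact h e' x' hx

lemma Policy.mem_compat_run (σ : Policy V) (φ : V → Bool) (ℓ : ℕ) :
    φ ∈ (σ.run φ ℓ).compat := by
  induction ℓ with
  | zero =>
    rw [PartialRealization.mem_compat]
    intro e x h
    simp [Policy.run] at h
  | succ ℓ ih =>
    rw [PartialRealization.mem_compat] at ih ⊢
    rw [Policy.run_succ]
    intro e x h
    cases hσ : σ (σ.run φ ℓ) with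
    | none =>
      rw [Policy.step_of_none hσ] at h
      exact ih e x h
    | some e' =>
      rw [Policy.step_of_some hσ] at h
      by_cases hee : e = e'
      · subst hee; simpa using h
      · rw [Function.update_of_ne hee] at h
        exact ih e x h

/-- A run reads only the outcomes it records, so outcomes that agree with the record reproduce it.
Hence the reachable records partition the complete outcomes. -/
lemma Policy.run_eq_of_mem_compat (σ : Policy V) {φ φ' : V → Bool} {ℓ : ℕ}
    (h : φ' ∈ (σ.run φ ℓ).compat) : σ.run φ' ℓ = σ.run φ ℓ := by
  induction ℓ with
  | zero => rfl
  | succ ℓ ih =>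
    have hφ := σ.mem_compat_run φ ℓ
    rw [Policy.run_succ, Policy.run_succ]
    rw [Policy.run_succ] at h
    have hmem : φ' ∈ (σ.run φ ℓ).compat := by
      rw [PartialRealization.mem_compat] at h hφ ⊢
      intro e x hx
      refine h e x ?_
      cases hσ : σ (σ.run φ ℓ) with
      | none => rw [Policy.step_of_none hσ]; exact hx
      | some e' =>
        rw [Policy.step_of_some hσ]
        by_cases hee : e = e'
        · subst hee; simp [hφ e x hx]
        · rw [Function.update_of_ne hee]; exact hx
    rw [ih hmem]
    cases hσ : σ (σ.run φ ℓ) with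
    | none => rw [Policy.step_of_none hσ, Policy.step_of_none hσ]
    | some e =>
      rw [Policy.step_of_some hσ, PartialRealization.mem_compat] at h
      rw [Policy.step_of_some hσ, Policy.step_of_some hσ, h e (φ e) (by simp)]

/-- The partial realizations that can occur after `ℓ` steps. -/
def Policy.reach (σ : Policy V) (ℓ : ℕ) : Finset (PartialRealization V) :=
  Finset.univ.image fun φ => σ.run φ ℓ

lemma Policy.run_eq_iff (σ : Policy V) {ψ : PartialRealization V} {ℓ : ℕ} (hψ : ψ ∈ σ.reach ℓ)
    {φ : V → Bool} : σ.run φ ℓ = ψ ↔ φ ∈ ψ.compat := by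
  obtain ⟨φ', -, rfl⟩ := Finset.mem_image.1 hψ
  exact ⟨fun h => h ▸ σ.mem_compat_run φ ℓ, σ.run_eq_of_mem_compat⟩

lemma Policy.sum_eq_sum_reach (σ : Policy V) (ℓ : ℕ) (F : (V → Bool) → ℝ) :
    ∑ φ, F φ = ∑ ψ ∈ σ.reach ℓ, ∑ φ ∈ ψ.compat, F φ := by
  rw [← Finset.sum_fiberwise_of_maps_to (t := σ.reach ℓ) (g := fun φ => σ.run φ ℓ)
    (fun φ _ => Finset.mem_image_of_mem _ (Finset.mem_univ φ))]
  refine Finset.sum_congr rfl fun ψ hψ => Finset.sum_congr ?_ fun _ _ => rfl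
  ext φ
  simp [σ.run_eq_iff hψ]

lemma PartialRealization.sum_compat_update {ψ : PartialRealization V} {e : V} (he : ψ e = none)
    (F : (V → Bool) → ℝ) :
    ∑ φ ∈ ψ.compat, F φ =
      ∑ x, ∑ φ ∈ PartialRealization.compat (Function.update ψ e (some x)), F φ := by
  rw [← Finset.sum_fiberwise ψ.compat fun φ => φ e]
  refine Finset.sum_congr rfl fun x _ => Finset.sum_congr ?_ fun _ _ => rfl
  ext φ
  rw [PartialRealization.mem_compat_update he, Finset.mem_filter]

end Compat

/-! ### Probabilities of partial realizations -/

noncomputable section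

namespace TestModel

variable {Θ V Y : Type*} [Fintype Θ] [Fintype V] (M : TestModel Θ V Y)

/-- `ℙ(θ, φ)`. -/
def full (θ : Θ) (φ : V → Bool) : ℝ := M.prior θ * ∏ e, M.lik e θ (φ e)

/-- `ℙ(ψ)`. -/
def mass (ψ : PartialRealization V) : ℝ := ∑ θ, M.joint ψ θ

lemma full_nonneg (θ : Θ) (φ : V → Bool) : 0 ≤ M.full θ φ :=
  mul_nonneg (M.prior_pos θ).le (Finset.prod_nonneg fun e _ => M.lik_nonneg e θ _)

lemma outcomeProb_eq (φ : V → Bool) : M.outcomeProb φ = ∑ θ, M.full θ φ := rfl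

lemma joint_nonneg (ψ : PartialRealization V) (θ : Θ) : 0 ≤ M.joint ψ θ := by
  refine mul_nonneg (M.prior_pos θ).le (Finset.prod_nonneg fun e _ => ?_)
  cases ψ e
  · exact zero_le_one
  · exact M.lik_nonneg e θ _

lemma mass_nonneg (ψ : PartialRealization V) : 0 ≤ M.mass ψ :=
  Finset.sum_nonneg fun θ _ => M.joint_nonneg ψ θ

/-- This survives division by zero: zero mass forces every joint probability to vanish. -/
lemma joint_eq_mass_mul_posterior (ψ : PartialRealization V) (θ : Θ) :
    M.joint ψ θ = M.mass ψ * M.posterior ψ θ := by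
  rcases (M.mass_nonneg ψ).eq_or_lt with h | h
  · have := (Finset.sum_eq_zero_iff_of_nonneg fun θ _ => M.joint_nonneg ψ θ).1 h.symm θ
      (Finset.mem_univ θ)
    rw [this, ← h, zero_mul]
  · rw [posterior, ← mass, mul_div_cancel₀ _ h.ne']

lemma posterior_nonneg (ψ : PartialRealization V) (θ : Θ) : 0 ≤ M.posterior ψ θ :=
  div_nonneg (M.joint_nonneg ψ θ) (M.mass_nonneg ψ)

lemma sum_posterior {ψ : PartialRealization V} (h : 0 < M.mass ψ) : ∑ θ, M.posterior ψ θ = 1 := by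
  simp only [posterior, ← Finset.sum_div]
  exact div_self h.ne'

lemma nonempty_rootCause {Θ V Y : Type*} [Fintype Θ] (M : TestModel Θ V Y) : Nonempty Θ := by
  by_contra hcon
  rw [not_nonempty_iff] at hcon
  have := M.prior_sum
  simp at this

variable [DecidableEq V]

lemma sum_compat_full (ψ : PartialRealization V) (θ : Θ) :
    ∑ φ ∈ ψ.compat, M.full θ φ = M.joint ψ θ := by
  simp only [full, ← Finset.mul_sum]
  rw [PartialRealization.compat, ← Finset.prod_univ_sum, joint]
  congr 1
  refine Finset.prod_congr rfl fun e _ => ?_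
  cases ψ e
  · exact M.lik_sum e θ
  · simp

lemma sum_compat_outcomeProb (ψ : PartialRealization V) :
    ∑ φ ∈ ψ.compat, M.outcomeProb φ = M.mass ψ := by
  simp only [outcomeProb_eq]
  rw [Finset.sum_comm]
  exact Finset.sum_congr rfl fun θ _ => M.sum_compat_full ψ θ

lemma joint_update {ψ : PartialRealization V} {e : V} (he : ψ e = none) (x : Bool) (θ : Θ) :
    M.joint (Function.update ψ e (some x)) θ = M.joint ψ θ * M.lik e θ x := by
  rw [joint, joint, ← Finset.mul_prod_erase _ _ (Finset.mem_univ e),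
    ← Finset.mul_prod_erase _ (fun e => (ψ e).elim 1 (M.lik e θ)) (Finset.mem_univ e),
    Function.update_self, he, Finset.prod_congr rfl fun e' he' => by
      rw [Function.update_of_ne (Finset.ne_of_mem_erase he')]]
  simp only [Option.elim]
  ring

lemma mass_update {ψ : PartialRealization V} {e : V} (he : ψ e = none) (x : Bool) :
    M.mass (Function.update ψ e (some x)) = M.mass ψ * M.predictive ψ e x := by
  rw [mass, predictive, Finset.mul_sum]
  refine Finset.sum_congr rfl fun θ _ => ?_
  rw [M.joint_update he, joint_eq_mass_mul_posterior, mul_assoc]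

lemma posterior_update {ψ : PartialRealization V} {e : V} (he : ψ e = none) (h : 0 < M.mass ψ)
    (x : Bool) (θ : Θ) :
    M.posterior (Function.update ψ e (some x)) θ =
      M.posterior ψ θ * M.lik e θ x / M.predictive ψ e x := by
  rw [posterior, ← mass, M.mass_update he, M.joint_update he, joint_eq_mass_mul_posterior,
    mul_assoc, mul_div_mul_left _ _ h.ne']

lemma expect_run (σ : Policy V) (ℓ : ℕ) (g : PartialRealization V → ℝ) :
    M.expect (fun φ => g (σ.run φ ℓ)) = ∑ ψ ∈ σ.reach ℓ, M.mass ψ * g ψ := by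
  rw [expect, σ.sum_eq_sum_reach ℓ]
  refine Finset.sum_congr rfl fun ψ hψ => ?_
  rw [← M.sum_compat_outcomeProb, Finset.sum_mul]
  exact Finset.sum_congr rfl fun φ hφ => by rw [(σ.run_eq_iff hψ).2 hφ]

lemma sum_mass_reach (σ : Policy V) (ℓ : ℕ) : ∑ ψ ∈ σ.reach ℓ, M.mass ψ = 1 := by
  have h1 : ∑ ψ ∈ σ.reach ℓ, M.mass ψ = ∑ φ, M.outcomeProb φ := by
    rw [σ.sum_eq_sum_reach ℓ]
    exact Finset.sum_congr rfl fun ψ _ => (M.sum_compat_outcomeProb ψ).symm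
  have h2 : ∑ φ, M.outcomeProb φ = M.mass fun _ => none := by
    rw [← M.sum_compat_outcomeProb]
    refine Finset.sum_congr ?_ fun _ _ => rfl
    ext φ
    simp [PartialRealization.mem_compat]
  rw [h1, h2, mass, ← M.prior_sum]
  exact Finset.sum_congr rfl fun θ _ => by simp [joint]

end TestModel

end

/-! ### Edge weights of a test -/

noncomputable section

section Weights

variable {Θ Y : Type*} [Fintype Θ] [DecidableEq Y]

/-- The expected weight of the edges that do not survive the noise-free outcome of a test. -/
def tripleWeight (r : Θ → Y) (p : Θ → ℝ) (ty : Θ → Bool) : ℝ :=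
  ∑ θ'', ∑ θ, ∑ θ', if r θ ≠ r θ' ∧ ¬(ty θ = ty θ'' ∧ ty θ' = ty θ'') then
    p θ'' * (p θ * p θ') else 0

lemma crossWeight_nonneg {r : Θ → Y} {p : Θ → ℝ} (h : ∀ θ, 0 ≤ p θ) (ty : Θ → Bool) :
    0 ≤ crossWeight r p ty :=
  Finset.sum_nonneg fun θ _ => Finset.sum_nonneg fun θ' _ => by
    split_ifs
    · exact mul_nonneg (h θ) (h θ')
    · exact le_rfl

lemma crossWeight_mono {r : Θ → Y} {p q : Θ → ℝ} (h : ∀ θ, 0 ≤ p θ) (hpq : ∀ θ, p θ ≤ q θ)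
    (ty : Θ → Bool) : crossWeight r p ty ≤ crossWeight r q ty :=
  Finset.sum_le_sum fun θ _ => Finset.sum_le_sum fun θ' _ => by
    split_ifs
    · exact mul_le_mul (hpq θ) (hpq θ') (h θ') ((h θ).trans (hpq θ))
    · exact le_rfl

lemma tripleWeight_nonneg {r : Θ → Y} {p : Θ → ℝ} (h : ∀ θ, 0 ≤ p θ) (ty : Θ → Bool) :
    0 ≤ tripleWeight r p ty :=
  Finset.sum_nonneg fun θ'' _ => Finset.sum_nonneg fun θ _ => Finset.sum_nonneg fun θ' _ => by
    split_ifs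
    · exact mul_nonneg (h θ'') (mul_nonneg (h θ) (h θ'))
    · exact le_rfl

lemma crossWeight_le_tripleWeight {r : Θ → Y} {p : Θ → ℝ} (h : ∀ θ, 0 ≤ p θ)
    (h1 : ∑ θ, p θ = 1) (ty : Θ → Bool) : crossWeight r p ty ≤ tripleWeight r p ty := by
  rw [← one_mul (crossWeight r p ty), ← h1, Finset.sum_mul]
  refine Finset.sum_le_sum fun θ'' _ => ?_
  rw [crossWeight, Finset.mul_sum]
  refine Finset.sum_le_sum fun θ _ => ?_
  rw [Finset.mul_sum]
  refine Finset.sum_le_sum fun θ' _ => ?_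
  have h3 := mul_nonneg (h θ'') (mul_nonneg (h θ) (h θ'))
  by_cases hc : r θ ≠ r θ' ∧ ty θ ≠ ty θ'
  · rw [if_pos hc, if_pos ⟨hc.1, fun hs => hc.2 (hs.1.trans hs.2.symm)⟩]
  · rw [if_neg hc, mul_zero]
    split_ifs
    · exact h3
    · exact le_rfl

/-- An edge that does not survive the outcome of `θ''` is either separated itself, or lies wholly on
the other side from `θ''`. In the second case its ends have different targets, so at least one of
them forms a separated edge with `θ''`. This gives three kinds of terms with equal sums. -/
lemma tripleWeight_le {r : Θ → Y} {p : Θ → ℝ} (h : ∀ θ, 0 ≤ p θ) (ty : Θ → Bool) :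
    tripleWeight r p ty ≤ 3 * ((∑ θ, p θ) * crossWeight r p ty) := by
  let C : Θ → Θ → ℝ := fun θ θ' => if r θ ≠ r θ' ∧ ty θ ≠ ty θ' then p θ * p θ' else 0
  have hC0 : ∀ θ θ', 0 ≤ C θ θ' := fun θ θ' => by
    simp only [C]
    split_ifs
    · exact mul_nonneg (h θ) (h θ')
    · exact le_rfl
  have hC : ∀ {θ θ'}, r θ ≠ r θ' → ty θ ≠ ty θ' → C θ θ' = p θ * p θ' := fun hr ht =>
    if_pos ⟨hr, ht⟩
  have hpt : tripleWeight r p ty ≤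
      ∑ θ'', ∑ θ, ∑ θ', (p θ'' * C θ θ' + p θ' * C θ θ'' + p θ * C θ' θ'') := by
    refine Finset.sum_le_sum fun θ'' _ => Finset.sum_le_sum fun θ _ =>
      Finset.sum_le_sum fun θ' _ => ?_
    have n1 := mul_nonneg (h θ'') (hC0 θ θ')
    have n2 := mul_nonneg (h θ') (hC0 θ θ'')
    have n3 := mul_nonneg (h θ) (hC0 θ' θ'')
    split_ifs with hc
    · obtain ⟨hr, ht⟩ := hc
      by_cases h1 : ty θ = ty θ'
      · have h2 : ty θ ≠ ty θ'' := fun h2 => ht ⟨h2, h1 ▸ h2⟩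
        by_cases h3 : r θ = r θ''
        · rw [hC (show r θ' ≠ r θ'' from fun h4 => hr (h3.trans h4.symm)) (h1 ▸ h2)] at n3 ⊢
          linarith
        · rw [hC h3 h2] at n2 ⊢
          linarith
      · rw [hC hr h1]
        linarith
    · positivity
  have e1 : ∑ θ'', ∑ θ, ∑ θ', p θ'' * C θ θ' = (∑ θ, p θ) * crossWeight r p ty := by
    rw [Finset.sum_mul]
    refine Finset.sum_congr rfl fun θ'' _ => ?_
    simp only [crossWeight, Finset.mul_sum, C]
  have e2 : ∑ θ'', ∑ θ, ∑ θ', p θ' * C θ θ'' = (∑ θ, p θ) * crossWeight r p ty := by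
    rw [← e1]
    calc ∑ θ'', ∑ θ, ∑ θ', p θ' * C θ θ'' = ∑ θ'', ∑ θ', ∑ θ, p θ' * C θ θ'' :=
          Finset.sum_congr rfl fun _ _ => Finset.sum_comm
      _ = ∑ θ', ∑ θ'', ∑ θ, p θ' * C θ θ'' := Finset.sum_comm
      _ = ∑ θ', ∑ θ, ∑ θ'', p θ' * C θ θ'' := Finset.sum_congr rfl fun _ _ => Finset.sum_comm
  have e3 : ∑ θ'', ∑ θ, ∑ θ', p θ * C θ' θ'' = (∑ θ, p θ) * crossWeight r p ty := by
    rw [← e1, Finset.sum_comm]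
    exact Finset.sum_congr rfl fun _ _ => Finset.sum_comm
  refine hpt.trans (le_of_eq ?_)
  simp only [Finset.sum_add_distrib]
  rw [e1, e2, e3]; ring

end Weights

lemma binEntropyBits_eq (p : ℝ) : binEntropyBits p = Real.binEntropy p / Real.log 2 := by
  rw [binEntropyBits, Real.binEntropy_eq_negMulLog_add_negMulLog_one_sub, Real.negMulLog,
    Real.negMulLog, Real.logb, Real.logb]
  ring

lemma mul_mul_log_one_div_mul (x y : ℝ) :
    x * y * Real.log (1 / (x * y)) = y * Real.negMulLog x + x * Real.negMulLog y := by
  rw [← Real.negMulLog_mul, one_div, Real.log_inv, Real.negMulLog]; ring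

lemma iSup_bool_eq_max (f : Bool → ℝ) : ⨆ x, f x = max (f true) (f false) := by
  refine le_antisymm (ciSup_le fun x => ?_) (max_le ?_ ?_)
  · cases x
    · exact le_max_right _ _
    · exact le_max_left _ _
  · exact le_ciSup (Set.finite_range f).bddAbove true
  · exact le_ciSup (Set.finite_range f).bddAbove false

/-- For noise rate `ε` and `ρ = ε / (1 - ε)`: the conditional expectation of the discount of an edge
is `ε (1 - ρ²)`, plus `((1 - 2ε) / (1 - ε))²` if the edge does not survive the noise-free outcome. -/
lemma sum_flipLik_mul_discount {ε : ℝ} (hε : ε ≠ 1) (t t' s : Bool) :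
    ∑ x, flipLik ε s x * (1 - flipLik ε t x / (1 - ε) * (flipLik ε t' x / (1 - ε))) =
      ε * (1 - (ε / (1 - ε)) ^ 2) +
        if ¬(t = s ∧ t' = s) then ((1 - 2 * ε) / (1 - ε)) ^ 2 else 0 := by
  have h : 1 - ε ≠ 0 := sub_ne_zero.2 hε.symm
  cases t <;> cases t' <;> cases s <;> simp [flipLik] <;> field_simp <;> ring

/-! ### ECED gain and auxiliary function in terms of these weights -/

namespace TestModel

variable {Θ V Y : Type*} [Fintype Θ] (M : TestModel Θ V Y)

section Noise

/-- The noise-free outcome of a test. -/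
def noiseFree (e : V) (θ : Θ) : Bool := decide (M.lik e θ false ≤ M.lik e θ true)

lemma iSup_lik {ε : V → ℝ} (hε : ∀ e θ, M.noiseRate e θ = ε e) (e : V) (θ : Θ) :
    ⨆ x, M.lik e θ x = 1 - ε e := by
  have := hε e θ
  rw [noiseRate] at this
  linarith

/-- With two outcomes, a noise rate independent of the root-cause makes the test a binary symmetric
channel applied to the noise-free outcome. -/
lemma lik_eq_flipLik {ε : V → ℝ} (hε : ∀ e θ, M.noiseRate e θ = ε e) (e : V) (θ : Θ) (x : Bool) :
    M.lik e θ x = flipLik (ε e) (M.noiseFree e θ) x := by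
  have h1 := M.iSup_lik hε e θ
  have h2 := M.lik_sum e θ
  rw [iSup_bool_eq_max] at h1
  rw [Fintype.sum_bool] at h2
  rw [flipLik, noiseFree]
  rcases le_or_gt (M.lik e θ false) (M.lik e θ true) with h | h
  · rw [max_eq_left h] at h1
    cases x <;> simp [h] <;> linarith
  · rw [max_eq_right h.le] at h1
    cases x <;> simp [not_le.2 h] <;> linarith

lemma noise_nonneg {ε : V → ℝ} (hε : ∀ e θ, M.noiseRate e θ = ε e) (e : V) : 0 ≤ ε e := by
  obtain ⟨θ⟩ := M.nonempty_rootCause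
  have h := M.lik_nonneg e θ (!M.noiseFree e θ)
  rw [M.lik_eq_flipLik hε, flipLik, if_neg (by simp)] at h
  exact h

lemma noise_le_half {ε : V → ℝ} (hε : ∀ e θ, M.noiseRate e θ = ε e) (e : V) : ε e ≤ 1 / 2 := by
  obtain ⟨θ⟩ := M.nonempty_rootCause
  have h1 := M.iSup_lik hε e θ
  have h2 := M.lik_sum e θ
  rw [iSup_bool_eq_max] at h1
  rw [Fintype.sum_bool] at h2
  have := le_max_left (M.lik e θ true) (M.lik e θ false)
  have := le_max_right (M.lik e θ true) (M.lik e θ false)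
  linarith

lemma ratio_eq {ε : V → ℝ} (hε : ∀ e θ, M.noiseRate e θ = ε e) (e : V) (θ : Θ) (x : Bool) :
    M.ratio e θ x = flipLik (ε e) (M.noiseFree e θ) x / (1 - ε e) := by
  rw [ratio, M.iSup_lik hε, M.lik_eq_flipLik hε]

variable [Fintype V]

lemma predictive_eq {ε : V → ℝ} (hε : ∀ e θ, M.noiseRate e θ = ε e) (ψ : PartialRealization V)
    (e : V) (x : Bool) :
    M.predictive ψ e x = ∑ θ, M.posterior ψ θ * flipLik (ε e) (M.noiseFree e θ) x := by
  rw [predictive]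
  exact Finset.sum_congr rfl fun θ _ => by rw [M.lik_eq_flipLik hε]

end Noise

variable [DecidableEq Y]

lemma sum_edges (f : Θ → Θ → ℝ) :
    ∑ q ∈ M.edges, f q.1 q.2 = ∑ θ, ∑ θ', if M.r θ ≠ M.r θ' then f θ θ' else 0 := by
  rw [edges, Finset.sum_filter, Fintype.sum_prod_type]

variable [Fintype V]

/-- The total weight of the edges. -/
def edgeWeight (ψ : PartialRealization V) : ℝ :=
  ∑ q ∈ M.edges, M.joint ψ q.1 * M.joint ψ q.2

lemma edgeWeight_nonneg (ψ : PartialRealization V) : 0 ≤ M.edgeWeight ψ :=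
  Finset.sum_nonneg fun _ _ => mul_nonneg (M.joint_nonneg ψ _) (M.joint_nonneg ψ _)

/-- Conditioning on the true root-cause `θ''`, the first term is the discount that noise alone
inflicts on every edge; it is what the offset of `ecedGainNoise` removes. -/
lemma sum_predictive_mul_basicValue {ε : V → ℝ} (hε : ∀ e θ, M.noiseRate e θ = ε e)
    {ψ : PartialRealization V} (h : 0 < M.mass ψ) (e : V) :
    ∑ x, M.predictive ψ e x * M.basicValue ψ e x =
      ε e * (1 - (ε e / (1 - ε e)) ^ 2) * M.edgeWeight ψ +
        ((1 - 2 * ε e) / (1 - ε e)) ^ 2 *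
          (M.mass ψ ^ 2 * tripleWeight M.r (M.posterior ψ) (M.noiseFree e)) := by
  have hε1 : ε e ≠ 1 := by have := M.noise_le_half hε e; intro h; linarith
  set p := M.posterior ψ with hp
  have e1 : ∑ x, M.predictive ψ e x * M.basicValue ψ e x =
      ∑ θ'', ∑ θ, ∑ θ', if M.r θ ≠ M.r θ' then p θ'' * (M.joint ψ θ * M.joint ψ θ') *
        ∑ x, flipLik (ε e) (M.noiseFree e θ'') x *
          (1 - flipLik (ε e) (M.noiseFree e θ) x / (1 - ε e) *
            (flipLik (ε e) (M.noiseFree e θ') x / (1 - ε e))) else 0 := by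
    have e0 : ∀ x, M.predictive ψ e x * M.basicValue ψ e x =
        ∑ θ'', ∑ θ, ∑ θ', if M.r θ ≠ M.r θ' then p θ'' * (M.joint ψ θ * M.joint ψ θ') *
          (flipLik (ε e) (M.noiseFree e θ'') x *
          (1 - flipLik (ε e) (M.noiseFree e θ) x / (1 - ε e) *
            (flipLik (ε e) (M.noiseFree e θ') x / (1 - ε e)))) else 0 := by
      intro x
      rw [M.predictive_eq hε, basicValue, M.sum_edges fun θ θ' =>
        M.joint ψ θ * M.joint ψ θ' * (1 - M.ratio e θ x * M.ratio e θ' x), Finset.sum_mul]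
      refine Finset.sum_congr rfl fun θ'' _ => ?_
      rw [Finset.mul_sum]
      refine Finset.sum_congr rfl fun θ _ => ?_
      rw [Finset.mul_sum]
      refine Finset.sum_congr rfl fun θ' _ => ?_
      split_ifs
      · rw [M.ratio_eq hε, M.ratio_eq hε]; ring
      · rw [mul_zero]
    rw [Finset.sum_congr rfl fun x _ => e0 x, Finset.sum_comm]
    refine Finset.sum_congr rfl fun θ'' _ => ?_
    rw [Finset.sum_comm]
    refine Finset.sum_congr rfl fun θ _ => ?_
    rw [Finset.sum_comm]
    refine Finset.sum_congr rfl fun θ' _ => ?_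
    split_ifs
    · rw [Finset.mul_sum]
    · simp
  have e2 : M.edgeWeight ψ = ∑ θ'', ∑ θ, ∑ θ', if M.r θ ≠ M.r θ' then
      p θ'' * (M.joint ψ θ * M.joint ψ θ') else 0 := by
    rw [edgeWeight, M.sum_edges fun θ θ' => M.joint ψ θ * M.joint ψ θ',
      ← one_mul (∑ θ, ∑ θ', _), ← M.sum_posterior h, Finset.sum_mul]
    refine Finset.sum_congr rfl fun θ'' _ => ?_
    rw [Finset.mul_sum]
    refine Finset.sum_congr rfl fun θ _ => ?_
    rw [Finset.mul_sum]
    exact Finset.sum_congr rfl fun θ' _ => by rw [mul_ite, mul_zero]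
  rw [e1, e2, tripleWeight, Finset.mul_sum, Finset.mul_sum, Finset.mul_sum,
    ← Finset.sum_add_distrib]
  refine Finset.sum_congr rfl fun θ'' _ => ?_
  rw [Finset.mul_sum, Finset.mul_sum, Finset.mul_sum, ← Finset.sum_add_distrib]
  refine Finset.sum_congr rfl fun θ _ => ?_
  rw [Finset.mul_sum, Finset.mul_sum, Finset.mul_sum, ← Finset.sum_add_distrib]
  refine Finset.sum_congr rfl fun θ' _ => ?_
  rw [sum_flipLik_mul_discount hε1]
  by_cases hr : M.r θ = M.r θ'
  · simp [hr]
  · by_cases ht : M.noiseFree e θ = M.noiseFree e θ'' ∧ M.noiseFree e θ' = M.noiseFree e θ''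
    · simp [hr, ht]; ring
    · simp only [ne_eq, hr, ht, not_false_eq_true, if_true, and_self, joint_eq_mass_mul_posterior,
        ← hp]
      ring

lemma ecedGainNoise_eq {ε : V → ℝ} (hε : ∀ e θ, M.noiseRate e θ = ε e)
    {ψ : PartialRealization V} (h : 0 < M.mass ψ) (e : V) :
    M.ecedGainNoise ε e ψ = ((1 - 2 * ε e) / (1 - ε e)) ^ 2 *
      (M.mass ψ ^ 2 * tripleWeight M.r (M.posterior ψ) (M.noiseFree e)) := by
  rw [ecedGainNoise, M.sum_predictive_mul_basicValue hε h, edgeWeight]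
  ring

variable [Fintype Y]

/-- The logarithm of a product splits, and by symmetry both halves of the edge sum agree; summing
out the other end gives `1 - targetMass`. -/
lemma fAux_eq (c : ℝ) {ψ : PartialRealization V} (h : 0 < M.mass ψ) :
    M.fAux c ψ = auxNat M.r c (M.posterior ψ) / Real.log 2 := by
  have h1 := M.sum_posterior h
  rw [fAux, auxNat, Finset.sum_add_distrib, ← Finset.mul_sum, add_div]
  congr 1
  · set p := M.posterior ψ with hp
    have e1 : ∀ q : Θ × Θ, p q.1 * p q.2 * Real.logb 2 (1 / (p q.1 * p q.2)) =
        (p q.2 * Real.negMulLog (p q.1) + p q.1 * Real.negMulLog (p q.2)) / Real.log 2 := by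
      intro q
      rw [← mul_mul_log_one_div_mul, Real.logb]; ring
    rw [Finset.sum_congr rfl fun q _ => e1 q, ← Finset.sum_div]
    congr 1
    rw [M.sum_edges fun θ θ' => p θ' * Real.negMulLog (p θ) + p θ * Real.negMulLog (p θ')]
    have e2 : ∑ θ, ∑ θ', (if M.r θ ≠ M.r θ' then p θ' * Real.negMulLog (p θ) else 0) =
        ∑ y, (1 - targetMass M.r p y) * ∑ θ with M.r θ = y, Real.negMulLog (p θ) := by
      rw [← Finset.sum_fiberwise Finset.univ M.r]
      refine Finset.sum_congr rfl fun y _ => ?_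
      rw [Finset.mul_sum]
      refine Finset.sum_congr rfl fun θ hθ => ?_
      have e : 1 - targetMass M.r p y = ∑ θ', if y ≠ M.r θ' then p θ' else 0 := by
        rw [targetMass, ← h1, Finset.sum_filter, ← Finset.sum_sub_distrib]
        refine Finset.sum_congr rfl fun θ' _ => ?_
        by_cases hy : M.r θ' = y
        · simp [hy]
        · simp [hy, Ne.symm hy]
      rw [(Finset.mem_filter.1 hθ).2, e, Finset.sum_mul]
      exact Finset.sum_congr rfl fun θ' _ => by rw [ite_mul, zero_mul]
    have e3 : ∑ θ, ∑ θ', (if M.r θ ≠ M.r θ' then p θ * Real.negMulLog (p θ') else 0) =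
        ∑ θ, ∑ θ', (if M.r θ ≠ M.r θ' then p θ' * Real.negMulLog (p θ) else 0) := by
      rw [Finset.sum_comm]
      refine Finset.sum_congr rfl fun θ _ => Finset.sum_congr rfl fun θ' _ => ?_
      simp only [ne_eq, eq_comm]
    have e4 : ∑ θ, ∑ θ', (if M.r θ ≠ M.r θ' then
        p θ' * Real.negMulLog (p θ) + p θ * Real.negMulLog (p θ') else 0) =
        ∑ θ, ∑ θ', (if M.r θ ≠ M.r θ' then p θ' * Real.negMulLog (p θ) else 0) +
        ∑ θ, ∑ θ', (if M.r θ ≠ M.r θ' then p θ * Real.negMulLog (p θ') else 0) := by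
      simp only [← Finset.sum_add_distrib]
      refine Finset.sum_congr rfl fun θ _ => Finset.sum_congr rfl fun θ' _ => ?_
      split_ifs <;> simp
    rw [e4, e3, e2, ← two_mul, Finset.mul_sum]
    exact Finset.sum_congr rfl fun y _ => by ring
  · simp only [binEntropyBits_eq, ← Finset.sum_div]
    rw [mul_div_assoc]; rfl

lemma exists_errMAP_eq (ψ : PartialRealization V) :
    ∃ z, (∀ y, targetMass M.r (M.posterior ψ) y ≤ targetMass M.r (M.posterior ψ) z) ∧
      M.errMAP ψ = 1 - targetMass M.r (M.posterior ψ) z := by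
  obtain ⟨θ⟩ := M.nonempty_rootCause
  have : Nonempty Y := ⟨M.r θ⟩
  obtain ⟨z, hz⟩ := exists_eq_ciSup_of_finite (f := fun y => M.posteriorTarget ψ y)
  refine ⟨z, fun y => ?_, ?_⟩
  · change M.posteriorTarget ψ y ≤ M.posteriorTarget ψ z
    rw [hz]
    exact le_ciSup (Set.finite_range fun y => M.posteriorTarget ψ y).bddAbove y
  · rw [errMAP, ← hz]; rfl

lemma errMAP_mem_Icc (ψ : PartialRealization V) : M.errMAP ψ ∈ Set.Icc (0 : ℝ) 1 := by
  obtain ⟨z, -, hz⟩ := M.exists_errMAP_eq ψ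
  rw [hz]
  have h0 := targetMass_nonneg (r := M.r) (M.posterior_nonneg ψ) z
  refine ⟨?_, by linarith⟩
  rcases (M.mass_nonneg ψ).eq_or_lt with h | h
  · have : targetMass M.r (M.posterior ψ) z = 0 :=
      Finset.sum_eq_zero fun θ _ => by rw [posterior, ← mass, ← h, div_zero]
    rw [this]; norm_num
  · linarith [targetMass_le_one (r := M.r) (M.posterior_nonneg ψ) (M.sum_posterior h) z]

lemma errMAP_le {ψ : PartialRealization V} (h : 0 < M.mass ψ) :
    M.errMAP ψ ≤ 1 - 1 / Fintype.card Θ := by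
  have := M.nonempty_rootCause
  obtain ⟨z, hz, he⟩ := M.exists_errMAP_eq ψ
  have hn : (0 : ℝ) < Fintype.card Θ := by exact_mod_cast Fintype.card_pos
  have hs : 1 ≤ Fintype.card Θ * targetMass M.r (M.posterior ψ) z := by
    rw [← M.sum_posterior h, ← nsmul_eq_mul]
    refine Finset.sum_le_card_nsmul _ _ _ fun θ _ => le_trans ?_ (hz (M.r θ))
    exact Finset.single_le_sum (fun θ _ => M.posterior_nonneg ψ θ) (by simp)
  rw [he]
  have : 1 / (Fintype.card Θ : ℝ) ≤ targetMass M.r (M.posterior ψ) z := by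
    rw [div_le_iff₀ hn]; linarith
  linarith

/-! ### Expectations along a policy -/

variable [DecidableEq V]

lemma errAvg_le (σ : Policy V) (ℓ : ℕ) : M.errAvg σ ℓ ≤ 1 - 1 / Fintype.card Θ := by
  have e : ∑ ψ ∈ σ.reach ℓ, M.mass ψ * (1 - 1 / (Fintype.card Θ : ℝ)) =
      1 - 1 / Fintype.card Θ := by rw [← Finset.sum_mul, M.sum_mass_reach, one_mul]
  rw [errAvg, M.expect_run, ← e]
  refine Finset.sum_le_sum fun ψ _ => ?_
  rcases (M.mass_nonneg ψ).eq_or_lt with h | h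
  · simp [← h]
  · exact mul_le_mul_of_nonneg_left (M.errMAP_le h) h.le

/-- The pointwise bound involves the entropy of the MAP error; concavity brings the expectation
inside the entropy, so only the average error has to be at least `δ`. -/
lemma fAuxAvg_le {c δ : ℝ} (hc : 0 ≤ c) (hδ : 0 < δ) {σ : Policy V} {ℓ : ℕ}
    (h : δ ≤ M.errAvg σ ℓ) :
    M.fAuxAvg c σ ℓ ≤ (6 * c + 8) * Real.logb 2 (Fintype.card Θ / δ) * M.errAvg σ ℓ := by
  have := M.nonempty_rootCause
  have hn : (1 : ℝ) ≤ Fintype.card Θ := by exact_mod_cast Fintype.card_pos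
  have hl2 : 0 < Real.log 2 := Real.log_pos one_lt_two
  have hEnt : ∑ ψ ∈ σ.reach ℓ, M.mass ψ * Real.binEntropy (M.errMAP ψ) ≤
      Real.binEntropy (M.errAvg σ ℓ) := by
    rw [errAvg, M.expect_run]
    exact Real.strictConcave_binEntropy.concaveOn.le_map_sum (fun ψ _ => M.mass_nonneg ψ)
      (M.sum_mass_reach σ ℓ) fun ψ _ => M.errMAP_mem_Icc ψ
  have hpt : M.fAuxAvg c σ ℓ ≤ ∑ ψ ∈ σ.reach ℓ, M.mass ψ * ((3 * c + 4) *
      (Real.binEntropy (M.errMAP ψ) + M.errMAP ψ * Real.log (Fintype.card Θ)) / Real.log 2) := by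
    rw [fAuxAvg, M.expect_run]
    refine Finset.sum_le_sum fun ψ _ => ?_
    rcases (M.mass_nonneg ψ).eq_or_lt with h | h
    · simp [← h]
    · refine mul_le_mul_of_nonneg_left ?_ h.le
      obtain ⟨z, hz, he⟩ := M.exists_errMAP_eq ψ
      rw [M.fAux_eq c h, he]
      gcongr
      exact auxNat_le hc (M.posterior_nonneg ψ) (M.sum_posterior h) hz
  have hfin := binEntropy_add_mul_log_le hδ h hn (M.errAvg_le σ ℓ)
  calc M.fAuxAvg c σ ℓ ≤ _ := hpt
    _ = (3 * c + 4) / Real.log 2 * (∑ ψ ∈ σ.reach ℓ, M.mass ψ * Real.binEntropy (M.errMAP ψ) +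
          M.errAvg σ ℓ * Real.log (Fintype.card Θ)) := by
        rw [errAvg, M.expect_run, Finset.sum_mul, ← Finset.sum_add_distrib, Finset.mul_sum]
        exact Finset.sum_congr rfl fun ψ _ => by ring
    _ ≤ (3 * c + 4) / Real.log 2 *
          (2 * (M.errAvg σ ℓ * Real.log (Fintype.card Θ / δ))) := by
        refine mul_le_mul_of_nonneg_left (by linarith) (by positivity)
    _ = _ := by rw [Real.logb]; ring

/-- The expected decrease of the auxiliary function when test `e` is performed. -/
def testGain (c : ℝ) (ψ : PartialRealization V) (e : V) : ℝ :=
  M.fAux c ψ - ∑ x, M.predictive ψ e x * M.fAux c (Function.update ψ e (some x))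

/-- The expected decrease of the auxiliary function in one step of a policy. -/
def stepGain (c : ℝ) (σ : Policy V) (ψ : PartialRealization V) : ℝ :=
  (σ ψ).elim 0 (M.testGain c ψ)

lemma fAuxAvg_sub_succ (c : ℝ) {σ : Policy V} (hσ : ∀ ψ e, σ ψ = some e → ψ e = none) (ℓ : ℕ) :
    M.fAuxAvg c σ ℓ - M.fAuxAvg c σ (ℓ + 1) =
      ∑ ψ ∈ σ.reach ℓ, M.mass ψ * M.stepGain c σ ψ := by
  rw [fAuxAvg, fAuxAvg, expect, expect, ← Finset.sum_sub_distrib, σ.sum_eq_sum_reach ℓ]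
  refine Finset.sum_congr rfl fun ψ hψ => ?_
  have e1 : ∀ φ ∈ ψ.compat, M.outcomeProb φ * M.fAux c (σ.run φ ℓ) -
      M.outcomeProb φ * M.fAux c (σ.run φ (ℓ + 1)) =
      M.outcomeProb φ * M.fAux c ψ - M.outcomeProb φ * M.fAux c (σ.step φ ψ) := by
    intro φ hφ
    rw [Policy.run_succ, (σ.run_eq_iff hψ).2 hφ]
  rw [Finset.sum_congr rfl e1, Finset.sum_sub_distrib, ← Finset.sum_mul, M.sum_compat_outcomeProb]
  cases hs : σ ψ with
  | none =>
    simp only [Policy.step_of_none hs, stepGain, hs, Option.elim_none, ← Finset.sum_mul,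
      M.sum_compat_outcomeProb]
    ring
  | some e =>
    have he := hσ ψ e hs
    simp only [Policy.step_of_some hs, stepGain, hs, Option.elim_some, testGain]
    rw [PartialRealization.sum_compat_update he, mul_sub, Finset.mul_sum]
    congr 1
    refine Finset.sum_congr rfl fun x _ => ?_
    rw [← mul_assoc, ← M.mass_update he, ← M.sum_compat_outcomeProb, Finset.sum_mul]
    refine Finset.sum_congr rfl fun φ hφ => ?_
    rw [((PartialRealization.mem_compat_update he).1 hφ).2]

lemma crossWeight_le_testGain {ε : V → ℝ} (hε : ∀ e θ, M.noiseRate e θ = ε e) {c : ℝ}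
    (hc : 4 * (2 * (1 + Real.log (Fintype.card Θ)) ^ 2 + 8) ≤ c) {ψ : PartialRealization V}
    {e : V} (he : ψ e = none) (h : 0 < M.mass ψ) :
    (1 - 2 * ε e) ^ 2 / (2 * Real.log 2) * crossWeight M.r (M.posterior ψ) (M.noiseFree e) ≤
      M.testGain c ψ e := by
  have hl2 : 0 < Real.log 2 := Real.log_pos one_lt_two
  have key := crossWeight_le_auxNat_sub (r := M.r) (M.posterior_nonneg ψ) (M.sum_posterior h)
    (M.noiseFree e) (M.noise_nonneg hε e) (M.noise_le_half hε e) hc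
  have hx : ∀ x, M.predictive ψ e x * M.fAux c (Function.update ψ e (some x)) =
      (∑ θ, M.posterior ψ θ * flipLik (ε e) (M.noiseFree e θ) x) * auxNat M.r c (fun θ =>
        M.posterior ψ θ * flipLik (ε e) (M.noiseFree e θ) x /
          ∑ θ, M.posterior ψ θ * flipLik (ε e) (M.noiseFree e θ) x) / Real.log 2 := by
    intro x
    rw [← M.predictive_eq hε]
    have h0 : 0 ≤ M.predictive ψ e x :=
      Finset.sum_nonneg fun θ _ => mul_nonneg (M.posterior_nonneg ψ θ) (M.lik_nonneg e θ x)
    -- An impossible outcome has junk posteriors but weight zero on both sides.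
    rcases h0.eq_or_lt with h0 | h0
    · simp [← h0]
    · rw [M.fAux_eq c (by rw [M.mass_update he]; exact mul_pos h h0), mul_div_assoc]
      congr 3
      funext θ
      rw [M.posterior_update he h, M.lik_eq_flipLik hε]
  rw [testGain, Finset.sum_congr rfl fun x _ => hx x, M.fAux_eq c h, ← Finset.sum_div, ← sub_div,
    le_div_iff₀ hl2]
  refine le_trans (le_of_eq ?_) key
  field_simp

end TestModel

end

/-! ### Noise-free tests: partitions into cells -/

section Cells

/-- The probability of guessing the target value within a cell with masses `m` is bounded by the
weight of the edges cut by the cell. -/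
lemma cell_mass_le {Y : Type*} [Fintype Y] {P m : Y → ℝ} {K : ℝ} (h0 : ∀ y, 0 ≤ m y)
    (hm : ∀ y, m y ≤ P y) (hP : ∑ y, P y = 1) (hK : ∀ y, P y ≤ K) (z : Y) :
    m z ≤ (∑ y, m y) * (K + (1 - ∑ y, P y ^ 2) - ((∑ y, m y) ^ 2 - ∑ y, m y ^ 2)) := by
  classical
  set α := ∑ y, m y with hα
  have hu : m z ≤ α := Finset.single_le_sum (fun y _ => h0 y) (Finset.mem_univ z)
  have hα0 : 0 ≤ α := (h0 z).trans hu
  have hα1 : α ≤ 1 := hP ▸ Finset.sum_le_sum fun y _ => hm y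
  have hP0 : ∀ y, 0 ≤ P y := fun y => (h0 y).trans (hm y)
  rcases le_total α (1 / 2) with h | h
  · have h1 : ∑ y, P y ^ 2 ≤ K := by
      calc ∑ y, P y ^ 2 ≤ ∑ y, P y * K := Finset.sum_le_sum fun y _ => by
            rw [sq]; exact mul_le_mul_of_nonneg_left (hK y) (hP0 y)
        _ = K := by rw [← Finset.sum_mul, hP, one_mul]
    have h2 : m z ^ 2 ≤ ∑ y, m y ^ 2 :=
      Finset.single_le_sum (f := fun y => m y ^ 2) (fun y _ => sq_nonneg _) (Finset.mem_univ z)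
    have h3 : α * (1 - α ^ 2 + m z ^ 2) ≤
        α * (K + (1 - ∑ y, P y ^ 2) - (α ^ 2 - ∑ y, m y ^ 2)) :=
      mul_le_mul_of_nonneg_left (by linarith) hα0
    -- This is `α (1 - α² + m z²) - m z`, factored; `α ≤ 1/2` makes the second factor nonnegative.
    have h4 : 0 ≤ (α - m z) * (1 - α * (α + m z)) := by
      refine mul_nonneg (by linarith) ?_
      nlinarith [h0 z]
    nlinarith
  · have hn : ∑ y, (P y - m y) = 1 - α := by rw [Finset.sum_sub_distrib, hP]
    have hn0 : ∀ y, 0 ≤ P y - m y := fun y => sub_nonneg.2 (hm y)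
    have hn1 : ∀ y, P y - m y ≤ 1 - α := fun y =>
      hn ▸ Finset.single_le_sum (fun y _ => hn0 y) (Finset.mem_univ y)
    have e : (1 - ∑ y, P y ^ 2) - (α ^ 2 - ∑ y, m y ^ 2) =
        ∑ y, (P y - m y) * (1 + α - m y - P y) := by
      have : ∀ y, (P y - m y) * (1 + α - m y - P y) =
          (P y - m y) * (1 + α) - P y ^ 2 + m y ^ 2 := fun y => by ring
      rw [Finset.sum_congr rfl fun y _ => this y, Finset.sum_add_distrib, Finset.sum_sub_distrib,
        ← Finset.sum_mul, hn]
      ring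
    -- For `y ≠ z` the factor is at least `2 (α - m y) ≥ 2 m z`, from `P y - m y ≤ 1 - α` and `m y +
    -- m z ≤ α`.
    have hlow : ∑ y ∈ Finset.univ.erase z, (P y - m y) * (2 * m z) ≤
        ∑ y, (P y - m y) * (1 + α - m y - P y) := by
      rw [← Finset.sum_erase_add (a := z) Finset.univ (fun y => (P y - m y) * (1 + α - m y - P y))
        (Finset.mem_univ z)]
      have hz : 0 ≤ (P z - m z) * (1 + α - m z - P z) :=
        mul_nonneg (hn0 z) (by linarith [hn1 z])
      refine le_add_of_le_of_nonneg (Finset.sum_le_sum fun y hy => ?_) hz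
      refine mul_le_mul_of_nonneg_left ?_ (hn0 y)
      have h2 : m y + m z ≤ α := by
        rw [hα, ← Finset.sum_pair (Finset.ne_of_mem_erase hy)]
        exact Finset.sum_le_sum_of_subset_of_nonneg (Finset.subset_univ _) fun y _ _ => h0 y
      linarith [hn1 y]
    have hsum : ∑ y ∈ Finset.univ.erase z, (P y - m y) = 1 - α - (P z - m z) := by
      rw [← hn, ← Finset.sum_erase_add (a := z) Finset.univ _ (Finset.mem_univ z)]; ring
    rw [← Finset.sum_mul, hsum, ← e] at hlow
    have hN : 0 ≤ 1 - α - (P z - m z) := by linarith [hn1 z]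
    have h5 : (1 - α - (P z - m z)) * m z ≤ α * ((1 - α - (P z - m z)) * (2 * m z)) := by
      nlinarith [mul_nonneg hN (h0 z)]
    have h6 : α * (P z + (1 - α - (P z - m z)) * (2 * m z)) ≤
        α * (K + (1 - ∑ y, P y ^ 2) - (α ^ 2 - ∑ y, m y ^ 2)) :=
      mul_le_mul_of_nonneg_left (by linarith [hK z]) hα0
    -- After using `2α ≥ 1`, exactly the surplus `(P z - m z)(α - m z)` remains.
    nlinarith [mul_nonneg (hn0 z) (sub_nonneg.2 hu)]

end Cells

noncomputable section

variable {Θ Y S : Type*} [Fintype Θ] [DecidableEq Y] [DecidableEq S]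

/-- The expected weight of the edges within the cell of the true root-cause, where `ρ` maps a
root-cause to its cell. -/
def survivingWeight (r : Θ → Y) (p : Θ → ℝ) (ρ : Θ → S) : ℝ :=
  ∑ θ'', ∑ θ, ∑ θ', if r θ ≠ r θ' ∧ ρ θ = ρ θ'' ∧ ρ θ' = ρ θ'' then
    p θ'' * (p θ * p θ') else 0

/-- The restriction of a distribution to a cell. -/
def cellRestrict (p : Θ → ℝ) (ρ : Θ → S) (s : S) (θ : Θ) : ℝ := if ρ θ = s then p θ else 0

omit [Fintype Θ] in
lemma cellRestrict_nonneg {p : Θ → ℝ} (h : ∀ θ, 0 ≤ p θ) (ρ : Θ → S) (s : S) (θ : Θ) :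
    0 ≤ cellRestrict p ρ s θ := by
  rw [cellRestrict]; split_ifs
  · exact h θ
  · exact le_rfl

omit [Fintype Θ] in
lemma cellRestrict_le {p : Θ → ℝ} (h : ∀ θ, 0 ≤ p θ) (ρ : Θ → S) (s : S) (θ : Θ) :
    cellRestrict p ρ s θ ≤ p θ := by
  rw [cellRestrict]; split_ifs
  · exact le_rfl
  · exact h θ

lemma sum_mul_eq_sum_cells [Fintype S] (p : Θ → ℝ) (ρ : Θ → S) (f : Θ → ℝ) :
    ∑ θ, p θ * f θ = ∑ s, ∑ θ, cellRestrict p ρ s θ * f θ := by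
  rw [← Finset.sum_fiberwise Finset.univ ρ]
  refine Finset.sum_congr rfl fun s _ => ?_
  rw [Finset.sum_filter]
  exact Finset.sum_congr rfl fun θ _ => by rw [cellRestrict, ite_mul, zero_mul]

lemma sum_cells [Fintype S] (p : Θ → ℝ) (ρ : Θ → S) :
    ∑ s, ∑ θ, cellRestrict p ρ s θ = ∑ θ, p θ := by
  simpa using (sum_mul_eq_sum_cells p ρ fun _ => 1).symm

lemma sum_edges_eq [Fintype Y] (r : Θ → Y) (q : Θ → ℝ) :
    ∑ θ, ∑ θ', (if r θ ≠ r θ' then q θ * q θ' else 0) =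
      (∑ θ, q θ) ^ 2 - ∑ y, targetMass r q y ^ 2 := by
  have e1 : ∑ y, targetMass r q y ^ 2 = ∑ θ, ∑ θ', if r θ = r θ' then q θ * q θ' else 0 := by
    rw [← Finset.sum_fiberwise Finset.univ r]
    refine Finset.sum_congr rfl fun y _ => ?_
    rw [sq, targetMass, Finset.sum_mul]
    refine Finset.sum_congr rfl fun θ hθ => ?_
    rw [(Finset.mem_filter.1 hθ).2, Finset.mul_sum, Finset.sum_filter]
    exact Finset.sum_congr rfl fun θ' _ => by simp only [eq_comm]
  rw [e1, sq, Finset.sum_mul, ← Finset.sum_sub_distrib]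
  refine Finset.sum_congr rfl fun θ _ => ?_
  rw [Finset.mul_sum, ← Finset.sum_sub_distrib]
  refine Finset.sum_congr rfl fun θ' _ => ?_
  split_ifs <;> simp_all

lemma survivingWeight_eq [Fintype S] (r : Θ → Y) (p : Θ → ℝ) (ρ : Θ → S) :
    survivingWeight r p ρ = ∑ s, (∑ θ, cellRestrict p ρ s θ) *
      ∑ θ, ∑ θ', if r θ ≠ r θ' then cellRestrict p ρ s θ * cellRestrict p ρ s θ' else 0 := by
  have e : survivingWeight r p ρ = ∑ θ'', p θ'' *
      ∑ θ, ∑ θ', if r θ ≠ r θ' ∧ ρ θ = ρ θ'' ∧ ρ θ' = ρ θ'' then p θ * p θ' else 0 := by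
    refine Finset.sum_congr rfl fun θ'' _ => ?_
    simp only [Finset.mul_sum, mul_ite, mul_zero]
  rw [e, sum_mul_eq_sum_cells p ρ]
  refine Finset.sum_congr rfl fun s _ => ?_
  rw [Finset.sum_mul]
  refine Finset.sum_congr rfl fun θ'' _ => ?_
  by_cases hs : ρ θ'' = s
  · congr 1
    refine Finset.sum_congr rfl fun θ _ => Finset.sum_congr rfl fun θ' _ => ?_
    simp only [cellRestrict, hs]
    by_cases h1 : ρ θ = s <;> by_cases h2 : ρ θ' = s <;> simp [h1, h2]
  · simp [cellRestrict, hs]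

/-- Guessing the target value from the cell of the root-cause is better than guessing it without
any information by at most the weight of the edges that are cut. -/
lemma sum_correct_le [Fintype S] [Fintype Y] {r : Θ → Y} {p : Θ → ℝ} (h : ∀ θ, 0 ≤ p θ)
    (h1 : ∑ θ, p θ = 1) {K : ℝ} (hK : ∀ y, targetMass r p y ≤ K) (ρ : Θ → S) (g : S → Y) :
    ∑ θ, (if r θ = g (ρ θ) then p θ else 0) ≤
      K + ∑ θ, ∑ θ', (if r θ ≠ r θ' then p θ * p θ' else 0) - survivingWeight r p ρ := by
  have e1 : ∑ θ, (if r θ = g (ρ θ) then p θ else 0) =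
      ∑ s, targetMass r (cellRestrict p ρ s) (g s) := by
    have : ∑ θ, (if r θ = g (ρ θ) then p θ else 0) =
        ∑ θ, p θ * (if r θ = g (ρ θ) then 1 else 0) := by simp
    rw [this, sum_mul_eq_sum_cells p ρ]
    refine Finset.sum_congr rfl fun s _ => ?_
    rw [targetMass, Finset.sum_filter]
    refine Finset.sum_congr rfl fun θ _ => ?_
    by_cases hs : ρ θ = s <;> simp [cellRestrict, hs]
  rw [e1, survivingWeight_eq, sum_edges_eq, h1, one_pow]
  -- Spreading the constant over the cells in proportion to their mass reduces the claim to
  -- `cell_mass_le` in each cell.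
  have e2 : K + (1 - ∑ y, targetMass r p y ^ 2) =
      ∑ s, (∑ θ, cellRestrict p ρ s θ) * (K + (1 - ∑ y, targetMass r p y ^ 2)) := by
    rw [← Finset.sum_mul, sum_cells, h1, one_mul]
  rw [e2, ← Finset.sum_sub_distrib]
  refine Finset.sum_le_sum fun s _ => ?_
  rw [sum_edges_eq, ← mul_sub, ← sum_targetMass r (cellRestrict p ρ s)]
  refine cell_mass_le (fun y => targetMass_nonneg (cellRestrict_nonneg h ρ s) y)
    (fun y => Finset.sum_le_sum fun θ _ => cellRestrict_le h ρ s θ) ((sum_targetMass r p).trans h1)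
    hK (g s)

/-- Refining every cell by one noise-free test removes at most three times the largest weight of
the edges separated by a test. -/
lemma survivingWeight_sub_le [Fintype S] {r : Θ → Y} {p : Θ → ℝ} (h : ∀ θ, 0 ≤ p θ)
    (h1 : ∑ θ, p θ = 1) {C B : ℝ} (hC : 0 ≤ C) {ρ ρ' : Θ → S} {t : S → Θ → Bool}
    (hρ : ∀ θ θ', ρ θ = ρ θ' → t (ρ θ) θ = t (ρ θ) θ' → ρ' θ = ρ' θ')
    (hB : ∀ s, C * crossWeight r p (t s) ≤ B) :
    C * (survivingWeight r p ρ - survivingWeight r p ρ') ≤ 3 * B := by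
  -- An edge lost from the cell of `θ''` must fail to survive the test attached to that cell.
  have e1 : survivingWeight r p ρ - survivingWeight r p ρ' ≤
      ∑ s, tripleWeight r (cellRestrict p ρ s) (t s) := by
    have e : ∑ s, tripleWeight r (cellRestrict p ρ s) (t s) = ∑ θ'', ∑ θ, ∑ θ',
        if (r θ ≠ r θ' ∧ ρ θ = ρ θ'' ∧ ρ θ' = ρ θ'') ∧
          ¬(t (ρ θ'') θ = t (ρ θ'') θ'' ∧ t (ρ θ'') θ' = t (ρ θ'') θ'') then
          p θ'' * (p θ * p θ') else 0 := by
      simp only [tripleWeight]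
      rw [Finset.sum_comm]
      refine Finset.sum_congr rfl fun θ'' _ => ?_
      rw [Finset.sum_eq_single (ρ θ'')]
      · refine Finset.sum_congr rfl fun θ _ => Finset.sum_congr rfl fun θ' _ => ?_
        simp only [cellRestrict]
        by_cases h1 : ρ θ = ρ θ'' <;> by_cases h2 : ρ θ' = ρ θ'' <;> simp [h1, h2]
      · intro s _ hs
        refine Finset.sum_eq_zero fun θ _ => Finset.sum_eq_zero fun θ' _ => ?_
        simp [cellRestrict, hs.symm]
      · simp
    rw [e, survivingWeight, survivingWeight, ← Finset.sum_sub_distrib]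
    refine Finset.sum_le_sum fun θ'' _ => ?_
    rw [← Finset.sum_sub_distrib]
    refine Finset.sum_le_sum fun θ _ => ?_
    rw [← Finset.sum_sub_distrib]
    refine Finset.sum_le_sum fun θ' _ => ?_
    have h3 := mul_nonneg (h θ'') (mul_nonneg (h θ) (h θ'))
    by_cases hc : r θ ≠ r θ' ∧ ρ θ = ρ θ'' ∧ ρ θ' = ρ θ''
    · by_cases hs : t (ρ θ'') θ = t (ρ θ'') θ'' ∧ t (ρ θ'') θ' = t (ρ θ'') θ''
      · have h4 : r θ ≠ r θ' ∧ ρ' θ = ρ' θ'' ∧ ρ' θ' = ρ' θ'' :=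
          ⟨hc.1, hρ _ _ hc.2.1 (by rw [hc.2.1]; exact hs.1),
            hρ _ _ hc.2.2 (by rw [hc.2.2]; exact hs.2)⟩
        rw [if_pos hc, if_pos h4, if_neg fun h5 => h5.2 hs, sub_self]
      · have h5 : (r θ ≠ r θ' ∧ ρ θ = ρ θ'' ∧ ρ θ' = ρ θ'') ∧
            ¬(t (ρ θ'') θ = t (ρ θ'') θ'' ∧ t (ρ θ'') θ' = t (ρ θ'') θ'') := ⟨hc, hs⟩
        rw [if_pos hc, if_pos h5]
        split_ifs <;> linarith
    · rw [if_neg hc]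
      split_ifs <;> linarith
  -- Each cell pays in proportion to its own mass, and the masses sum to one, so the number of cells
  -- does not enter.
  calc C * (survivingWeight r p ρ - survivingWeight r p ρ')
      ≤ C * ∑ s, 3 * ((∑ θ, cellRestrict p ρ s θ) * crossWeight r p (t s)) := by
        refine mul_le_mul_of_nonneg_left (e1.trans (Finset.sum_le_sum fun s _ => ?_)) hC
        refine (tripleWeight_le (cellRestrict_nonneg h ρ s) (t s)).trans ?_
        refine mul_le_mul_of_nonneg_left (mul_le_mul_of_nonneg_left
          (crossWeight_mono (cellRestrict_nonneg h ρ s) (cellRestrict_le h ρ s) _) ?_) (by norm_num)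
        exact Finset.sum_nonneg fun θ _ => cellRestrict_nonneg h ρ s θ
    _ = ∑ s, 3 * ((∑ θ, cellRestrict p ρ s θ) * (C * crossWeight r p (t s))) := by
        rw [Finset.mul_sum]
        exact Finset.sum_congr rfl fun s _ => by ring
    _ ≤ ∑ s, 3 * ((∑ θ, cellRestrict p ρ s θ) * B) := by
        refine Finset.sum_le_sum fun s _ => mul_le_mul_of_nonneg_left
          (mul_le_mul_of_nonneg_left (hB s) ?_) (by norm_num)
        exact Finset.sum_nonneg fun θ _ => cellRestrict_nonneg h ρ s θ
    _ = 3 * B := by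
        rw [← Finset.mul_sum, ← Finset.sum_mul, sum_cells, h1, one_mul]

lemma survivingWeight_const {r : Θ → Y} {p : Θ → ℝ} (h1 : ∑ θ, p θ = 1) {ρ : Θ → S}
    (hρ : ∀ θ θ', ρ θ = ρ θ') :
    survivingWeight r p ρ = ∑ θ, ∑ θ', if r θ ≠ r θ' then p θ * p θ' else 0 := by
  have e : survivingWeight r p ρ = ∑ θ'', p θ'' *
      ∑ θ, ∑ θ', if r θ ≠ r θ' then p θ * p θ' else 0 := by
    refine Finset.sum_congr rfl fun θ'' _ => ?_
    rw [Finset.mul_sum]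
    refine Finset.sum_congr rfl fun θ _ => ?_
    rw [Finset.mul_sum]
    refine Finset.sum_congr rfl fun θ' _ => ?_
    rw [hρ θ θ'', hρ θ' θ'']
    simp
  rw [e, ← Finset.sum_mul, h1, one_mul]

/-- With `k` noise-free tests the error probability decreases by at most `3 k` times the largest
weight of the edges separated by a test. -/
lemma error_sub_le [Fintype S] [Fintype Y] {r : Θ → Y} {p : Θ → ℝ} (h : ∀ θ, 0 ≤ p θ)
    (h1 : ∑ θ, p θ = 1) {C B : ℝ} (hC : 0 ≤ C) {ρ : ℕ → Θ → S} {t : S → Θ → Bool}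
    (h0 : ∀ θ θ', ρ 0 θ = ρ 0 θ')
    (hρ : ∀ j θ θ', ρ j θ = ρ j θ' → t (ρ j θ) θ = t (ρ j θ) θ' → ρ (j + 1) θ = ρ (j + 1) θ')
    (hB : ∀ s, C * crossWeight r p (t s) ≤ B) {K : ℝ} (hK : ∀ y, targetMass r p y ≤ K)
    (k : ℕ) (g : S → Y) :
    C * ((1 - K) - ∑ θ, (if r θ ≠ g (ρ k θ) then p θ else 0)) ≤ 3 * k * B := by
  have e1 : ∑ θ, (if r θ ≠ g (ρ k θ) then p θ else 0) =
      1 - ∑ θ, (if r θ = g (ρ k θ) then p θ else 0) := by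
    rw [← h1, ← Finset.sum_sub_distrib]
    exact Finset.sum_congr rfl fun θ _ => by split_ifs <;> simp_all
  have h2 := sum_correct_le h h1 hK (ρ k) g
  rw [← survivingWeight_const h1 h0] at h2
  have h3 : C * (survivingWeight r p (ρ 0) - survivingWeight r p (ρ k)) ≤ 3 * k * B := by
    clear h2 e1
    induction k with
    | zero => simp
    | succ k ih =>
      have := survivingWeight_sub_le h h1 hC (hρ k) hB
      push_cast
      linarith
  refine le_trans (mul_le_mul_of_nonneg_left ?_ hC) h3
  rw [e1]; linarith

end

/-! ### Number of steps and cost -/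

section Cost

variable {V : Type*} [Fintype V] [DecidableEq V]

lemma Policy.size_step_or (σ : Policy V) {φ : V → Bool} {ψ : PartialRealization V}
    (hφ : φ ∈ ψ.compat) : σ.step φ ψ = ψ ∨ (σ.step φ ψ).size = ψ.size + 1 := by
  cases hσ : σ ψ with
  | none => exact Or.inl (Policy.step_of_none hσ)
  | some e =>
    rw [Policy.step_of_some hσ]
    cases he : ψ e with
    | some x =>
      left
      rw [PartialRealization.mem_compat.1 hφ e x he, ← he, Function.update_eq_self]
    | none =>
      right
      rw [PartialRealization.size, PartialRealization.size]
      rw [← Finset.card_insert_of_notMem (a := e) (s := Finset.univ.filter fun e => (ψ e).isSome)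
        (by simp [he])]
      congr 1
      ext e'
      by_cases hee : e' = e
      · subst hee; simp
      · simp [hee]

omit [Fintype V] in
lemma Policy.run_eq_of_step_eq (σ : Policy V) {φ : V → Bool} {j : ℕ}
    (h : σ.step φ (σ.run φ j) = σ.run φ j) (i : ℕ) : σ.run φ (j + i) = σ.run φ j := by
  induction i with
  | zero => rfl
  | succ i ih => rw [← Nat.add_assoc, Policy.run_succ, ih, h]

/-- Outcomes are persistent, so a step that adds no test leaves the run stuck forever. -/
lemma Policy.size_run_or (σ : Policy V) (φ : V → Bool) (j : ℕ) :
    σ.step φ (σ.run φ j) = σ.run φ j ∨ (σ.run φ j).size = j := by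
  induction j with
  | zero => right; simp [Policy.run, PartialRealization.size]
  | succ j ih =>
    rcases σ.size_step_or (σ.mem_compat_run φ j) with h | h
    · left; rw [Policy.run_succ, h, h]
    · rcases ih with h' | h'
      · left; rw [Policy.run_succ, h', h']
      · right; rw [Policy.run_succ, h, h']

lemma Policy.size_run_mono (σ : Policy V) (φ : V → Bool) :
    Monotone fun j => (σ.run φ j).size := by
  refine monotone_nat_of_le_succ fun j => ?_
  rw [Policy.run_succ]
  rcases σ.size_step_or (σ.mem_compat_run φ j) with h | h <;> rw [h]
  exact Nat.le_succ _

omit [DecidableEq V] in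
lemma PartialRealization.size_le_card (ψ : PartialRealization V) : ψ.size ≤ Fintype.card V :=
  Finset.card_le_univ _

/-- If the run still moved at step `k`, its record would grow to size `k + 1`. -/
lemma Policy.final_eq_run (σ : Policy V) {φ : V → Bool} {k : ℕ} (hk : (σ.final φ).size ≤ k)
    (hkV : k ≤ Fintype.card V) : σ.final φ = σ.run φ k := by
  obtain ⟨i, hi⟩ := Nat.exists_eq_add_of_le hkV
  by_cases h : σ.step φ (σ.run φ k) = σ.run φ k
  · rw [Policy.final, hi, σ.run_eq_of_step_eq h]
  · have h1 := (σ.size_run_or φ k).resolve_left h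
    have h2 := (σ.size_step_or (σ.mem_compat_run φ k)).resolve_left h
    rw [← Policy.run_succ, h1] at h2
    rcases Nat.eq_zero_or_pos i with rfl | hi0
    · rw [Policy.final, hi]; rfl
    · have h3 : (σ.run φ (k + 1)).size ≤ (σ.run φ (Fintype.card V)).size :=
        σ.size_run_mono φ (by omega)
      rw [Policy.final] at hk
      omega

end Cost

/-! ### Uninformative tests -/

section CrossWeight

variable {Θ Y : Type*} [Fintype Θ] [DecidableEq Y]

lemma crossWeight_congr {r : Θ → Y} {p : Θ → ℝ} {ty ty' : Θ → Bool}
    (h : ∀ θ θ', ty θ = ty θ' ↔ ty' θ = ty' θ') : crossWeight r p ty = crossWeight r p ty' := by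
  simp only [crossWeight, ne_eq, h]

lemma crossWeight_eq_zero {r : Θ → Y} {p : Θ → ℝ} {ty : Θ → Bool}
    (h : ∀ θ θ', ty θ = ty θ') : crossWeight r p ty = 0 :=
  Finset.sum_eq_zero fun θ _ => Finset.sum_eq_zero fun θ' _ => if_neg fun hc => hc.2 (h θ θ')

lemma tripleWeight_eq_zero {r : Θ → Y} {p : Θ → ℝ} {ty : Θ → Bool}
    (h : ∀ θ θ', ty θ = ty θ') : tripleWeight r p ty = 0 :=
  Finset.sum_eq_zero fun θ'' _ => Finset.sum_eq_zero fun θ _ => Finset.sum_eq_zero fun θ' _ =>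
    if_neg fun hc => hc.2 ⟨h θ θ'', h θ' θ''⟩

lemma flipLik_nonneg {ε : ℝ} (h0 : 0 ≤ ε) (h1 : ε ≤ 1) (t x : Bool) : 0 ≤ flipLik ε t x := by
  rw [flipLik]; split_ifs <;> linarith

end CrossWeight

/-! ### Fixing the noise: comparison with an arbitrary policy -/

noncomputable section

namespace TestModel

variable {Θ V Y : Type*} [Fintype Θ] [Fintype V] (M : TestModel Θ V Y)

/-- The outcomes given the observations `ψ`, the root-cause `θ` and the noise pattern `z`. -/
def noisyOutcome (ψ : PartialRealization V) (θ : Θ) (z : V → Bool) (e : V) : Bool :=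
  xor ((ψ e).getD (M.noiseFree e θ)) (z e)

/-- The probability of the noise pattern `z` on the tests not performed in `ψ`. -/
def noiseProb (ε : V → ℝ) (ψ : PartialRealization V) (z : V → Bool) : ℝ :=
  ∏ e, if ψ e = none then flipLik (ε e) false (z e) else 1

variable [DecidableEq V]

/-- Change of variables by an involution, xor with the noise-free outcomes. The noise pattern then
has a law independent of `θ`, so it can be fixed before the root-cause is drawn. -/
lemma sum_compat_full_mul {ε : V → ℝ} (hε : ∀ e θ, M.noiseRate e θ = ε e)
    (ψ : PartialRealization V) (θ : Θ) (g : (V → Bool) → ℝ) :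
    ∑ φ ∈ ψ.compat, M.full θ φ * g φ =
      M.joint ψ θ * ∑ z ∈ PartialRealization.compat fun e => (ψ e).map fun _ => false,
        noiseProb ε ψ z * g (M.noisyOutcome ψ θ z) := by
  rw [Finset.mul_sum]
  refine Finset.sum_nbij' (fun φ => M.noisyOutcome ψ θ φ) (fun z => M.noisyOutcome ψ θ z)
    ?_ ?_ ?_ ?_ ?_
  · intro φ hφ
    rw [PartialRealization.mem_compat] at hφ ⊢
    intro e x hx
    rw [Option.map_eq_some_iff] at hx
    obtain ⟨y, hy, rfl⟩ := hx
    simp [noisyOutcome, hy, hφ e y hy]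
  · intro z hz
    rw [PartialRealization.mem_compat] at hz ⊢
    intro e x hx
    have := hz e false (by simp [hx])
    simp [noisyOutcome, hx, this]
  · intro φ _
    funext e
    simp [noisyOutcome]
  · intro φ _
    funext e
    simp [noisyOutcome]
  · intro φ hφ
    rw [PartialRealization.mem_compat] at hφ
    have e1 : M.noisyOutcome ψ θ (M.noisyOutcome ψ θ φ) = φ := by
      funext e
      simp [noisyOutcome]
    rw [e1, ← mul_assoc]
    congr 1
    rw [full, joint, noiseProb, mul_assoc, ← Finset.prod_mul_distrib]
    congr 1
    refine Finset.prod_congr rfl fun e _ => ?_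
    cases he : ψ e with
    | some x => simp [hφ e x he]
    | none =>
      simp only [Option.elim_none, if_true, one_mul, noisyOutcome, he, Option.getD_none]
      rw [M.lik_eq_flipLik hε]
      cases M.noiseFree e θ <;> cases φ e <;> simp [flipLik]

lemma sum_noiseProb {ε : V → ℝ} (hε : ∀ e θ, M.noiseRate e θ = ε e)
    {ψ : PartialRealization V} (h : 0 < M.mass ψ) :
    ∑ z ∈ PartialRealization.compat fun e => (ψ e).map fun _ => false, noiseProb ε ψ z = 1 := by
  have h1 : ∀ θ, M.joint ψ θ * ∑ z ∈ PartialRealization.compat fun e => (ψ e).map fun _ => false,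
      noiseProb ε ψ z = M.joint ψ θ := fun θ => by
    have := M.sum_compat_full_mul hε ψ θ fun _ => 1
    simp only [mul_one] at this
    rw [← this, M.sum_compat_full]
  have h2 : M.mass ψ * ∑ z ∈ PartialRealization.compat fun e => (ψ e).map fun _ => false,
      noiseProb ε ψ z = M.mass ψ := by
    rw [mass, Finset.sum_mul]
    exact Finset.sum_congr rfl fun θ _ => h1 θ
  exact (mul_eq_left₀ h.ne').1 h2

lemma cost_le_card (π : Policy V) : M.cost π ≤ Fintype.card V :=
  Finset.sup_le fun _ _ => PartialRealization.size_le_card _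

variable [Fintype Y] [DecidableEq Y]

/-- Starting from the observations `ψ`, an estimator based on `k` steps of any policy decreases the
error probability by at most `3 k` times the largest weight of the edges separated by a test. -/
lemma error_decrease_le {ε : V → ℝ} (hε : ∀ e θ, M.noiseRate e θ = ε e)
    {ψ : PartialRealization V} (h : 0 < M.mass ψ) {C B : ℝ} (hC : 0 ≤ C) (hB0 : 0 ≤ B)
    (hB : ∀ e, ψ e = none → C * crossWeight M.r (M.posterior ψ) (M.noiseFree e) ≤ B)
    (π : Policy V) (k : ℕ) (g : PartialRealization V → Y) :
    C * (M.mass ψ * M.errMAP ψ - ∑ θ, ∑ φ ∈ ψ.compat,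
      M.full θ φ * (if M.r θ ≠ g (π.run φ k) then 1 else 0)) ≤ M.mass ψ * (3 * k * B) := by
  obtain ⟨y₀, hy₀, herr⟩ := M.exists_errMAP_eq ψ
  set Z := PartialRealization.compat fun e => (ψ e).map fun _ => false
  have hz : ∀ z ∈ Z, C * (M.errMAP ψ - ∑ θ,
      (if M.r θ ≠ g (π.run (M.noisyOutcome ψ θ z) k) then M.posterior ψ θ else 0)) ≤
        3 * k * B := by
    intro z _
    rw [herr]
    -- With the noise fixed, cells are the records reached by `π`. A test already in `ψ` has the
    -- same outcome for all `θ` and separates nothing; for the others, xor with the noise leaves the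
    -- separated pairs unchanged.
    refine error_sub_le (M.posterior_nonneg ψ) (M.sum_posterior h) hC
      (ρ := fun j θ => π.run (M.noisyOutcome ψ θ z) j)
      (t := fun χ θ => (π χ).elim false (M.noisyOutcome ψ θ z)) (fun _ _ => rfl) ?_ ?_ hy₀ k g
    · intro j θ θ' hj ht
      simp only [Policy.run_succ, ← hj] at ht ⊢
      cases hπ : π (π.run (M.noisyOutcome ψ θ z) j) with
      | none => rw [Policy.step_of_none hπ, Policy.step_of_none hπ]
      | some e =>
        rw [hπ, Option.elim_some, Option.elim_some] at ht
        rw [Policy.step_of_some hπ, Policy.step_of_some hπ, ht]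
    · intro χ
      cases hπ : π χ with
      | none =>
        simp only [Option.elim_none]
        rw [crossWeight_eq_zero (by simp), mul_zero]
        exact hB0
      | some e =>
        simp only [Option.elim_some]
        cases he : ψ e with
        | some x =>
          rw [crossWeight_eq_zero (by simp [noisyOutcome, he]), mul_zero]
          exact hB0
        | none =>
          rw [crossWeight_congr (ty' := M.noiseFree e) (by simp [noisyOutcome, he])]
          exact hB e he
  have hν : ∀ z, 0 ≤ noiseProb ε ψ z := fun z => Finset.prod_nonneg fun e _ => by
    split_ifs
    · exact flipLik_nonneg (M.noise_nonneg hε e) (by linarith [M.noise_le_half hε e]) _ _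
    · exact zero_le_one
  have e1 : ∑ θ, ∑ φ ∈ ψ.compat, M.full θ φ * (if M.r θ ≠ g (π.run φ k) then 1 else 0) =
      M.mass ψ * ∑ z ∈ Z, noiseProb ε ψ z * ∑ θ,
        (if M.r θ ≠ g (π.run (M.noisyOutcome ψ θ z) k) then M.posterior ψ θ else 0) := by
    simp only [M.sum_compat_full_mul hε, joint_eq_mass_mul_posterior, Finset.mul_sum]
    rw [Finset.sum_comm]
    refine Finset.sum_congr rfl fun z _ => Finset.sum_congr rfl fun θ _ => ?_
    split_ifs <;> ring
  have e2 : M.mass ψ * M.errMAP ψ = M.mass ψ * ∑ z ∈ Z, noiseProb ε ψ z * M.errMAP ψ := by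
    rw [← Finset.sum_mul, M.sum_noiseProb hε h, one_mul]
  rw [e1, e2, ← mul_sub, ← Finset.sum_sub_distrib, mul_left_comm]
  refine mul_le_mul_of_nonneg_left ?_ h.le
  rw [Finset.mul_sum, ← one_mul (3 * k * B), ← M.sum_noiseProb hε h, Finset.sum_mul]
  refine Finset.sum_le_sum fun z hzZ => ?_
  have := mul_le_mul_of_nonneg_left (hz z hzZ) (hν z)
  linarith

omit [Fintype Y] in
-- Outcomes of probability zero may need more than `cost` steps, but carry no weight.
lemma policyErr_eq_errAvg (π : Policy V) : M.policyErr π = M.errAvg π (M.cost π) := by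
  rw [policyErr, errAvg, expect, expect]
  refine Finset.sum_congr rfl fun φ _ => ?_
  have h0 : 0 ≤ M.outcomeProb φ := Finset.sum_nonneg fun θ _ => M.full_nonneg θ φ
  rcases h0.eq_or_lt with h | h
  · rw [← h, zero_mul, zero_mul]
  · rw [π.final_eq_run (k := M.cost π) ?_ (M.cost_le_card π)]
    exact Finset.le_sup (f := fun φ => (π.final φ).size) (by simpa using h)

/-- The expected error probability is the error probability of a suitable estimator. -/
lemma exists_estimator (π : Policy V) (k : ℕ) : ∃ g : PartialRealization V → Y,
    ∑ φ, ∑ θ, M.full θ φ * (if M.r θ ≠ g (π.run φ k) then 1 else 0) = M.errAvg π k := by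
  choose g _ hg using M.exists_errMAP_eq
  refine ⟨g, ?_⟩
  rw [errAvg, M.expect_run, π.sum_eq_sum_reach k]
  refine Finset.sum_congr rfl fun χ hχ => ?_
  have e1 : ∑ φ ∈ χ.compat, ∑ θ, M.full θ φ * (if M.r θ ≠ g (π.run φ k) then (1 : ℝ) else 0) =
      ∑ θ, M.joint χ θ * (if M.r θ ≠ g χ then 1 else 0) := by
    rw [Finset.sum_comm]
    refine Finset.sum_congr rfl fun θ _ => ?_
    rw [← M.sum_compat_full, Finset.sum_mul]
    exact Finset.sum_congr rfl fun φ hφ => by rw [(π.run_eq_iff hχ).2 hφ]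
  rw [e1]
  simp only [joint_eq_mass_mul_posterior, mul_assoc, ← Finset.mul_sum]
  rcases (M.mass_nonneg χ).eq_or_lt with h | h
  · rw [← h, zero_mul, zero_mul]
  · congr 1
    rw [hg χ]
    refine eq_sub_of_add_eq (Eq.trans ?_ (M.sum_posterior h))
    rw [targetMass, Finset.sum_filter, ← Finset.sum_add_distrib]
    exact Finset.sum_congr rfl fun θ _ => by split_ifs <;> simp_all

/-- If every step of `σ` gains at least three times the weight separated by any other test, then
`cost π` steps of another policy `π` cannot do much better. -/
lemma mul_errAvg_sub_policyErr_le {ε : V → ℝ} (hε : ∀ e θ, M.noiseRate e θ = ε e) {C c : ℝ}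
    (hC : 0 ≤ C) {σ : Policy V} (hσ : ∀ ψ e, σ ψ = some e → ψ e = none)
    (hnn : ∀ ψ, 0 < M.mass ψ → 0 ≤ M.stepGain c σ ψ)
    (hstep : ∀ ψ, 0 < M.mass ψ → ∀ e, ψ e = none →
      3 * (C * crossWeight M.r (M.posterior ψ) (M.noiseFree e)) ≤ M.stepGain c σ ψ)
    (π : Policy V) (ℓ : ℕ) :
    C * (M.errAvg σ ℓ - M.policyErr π) ≤
      M.cost π * (M.fAuxAvg c σ ℓ - M.fAuxAvg c σ (ℓ + 1)) := by
  -- The estimator of `π` ignores what `σ` has seen. Its error is split over the records `ψ` of `σ`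
  -- and compared with the MAP error at each of them.
  obtain ⟨g, hg⟩ := M.exists_estimator π (M.cost π)
  rw [M.policyErr_eq_errAvg, ← hg, M.fAuxAvg_sub_succ c hσ, errAvg, M.expect_run,
    σ.sum_eq_sum_reach ℓ, ← Finset.sum_sub_distrib, Finset.mul_sum, Finset.mul_sum]
  refine Finset.sum_le_sum fun ψ _ => ?_
  rw [Finset.sum_comm]
  rcases (M.mass_nonneg ψ).eq_or_lt with h | h
  · have h0 : 0 ≤ ∑ θ, ∑ φ ∈ ψ.compat,
        M.full θ φ * (if M.r θ ≠ g (π.run φ (M.cost π)) then 1 else 0) :=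
      Finset.sum_nonneg fun θ _ => Finset.sum_nonneg fun φ _ =>
        mul_nonneg (M.full_nonneg θ φ) (by split_ifs <;> simp)
    rw [← h]
    have := mul_nonneg hC h0
    linarith
  · have := M.error_decrease_le hε h hC (B := M.stepGain c σ ψ / 3)
      (by linarith [hnn ψ h]) (fun e he => by linarith [hstep ψ h e he]) π (M.cost π) g
    linarith

end TestModel

end

/-! ### The greedy choice and the final estimate -/

noncomputable section

namespace TestModel

variable {Θ V Y : Type*} [Fintype Θ] [Fintype V] [DecidableEq Y] (M : TestModel Θ V Y)

omit [Fintype V] [DecidableEq Y] in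
lemma ratio_le_one {ε : V → ℝ} (hε : ∀ e θ, M.noiseRate e θ = ε e) (e : V) (θ : Θ) (x : Bool) :
    0 ≤ M.ratio e θ x ∧ M.ratio e θ x ≤ 1 := by
  have h0 := M.noise_nonneg hε e
  have h1 := M.noise_le_half hε e
  have h2 : 0 < 1 - ε e := by linarith
  rw [M.ratio_eq hε]
  refine ⟨div_nonneg (flipLik_nonneg h0 (by linarith) _ _) h2.le, ?_⟩
  rw [div_le_one h2, flipLik]
  split_ifs <;> linarith

lemma offsetValue_eq (ψ : PartialRealization V) (e : V) (x : Bool) :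
    M.offsetValue ψ e x = M.edgeWeight ψ * (1 - ⨆ θ, M.ratio e θ x ^ 2) := by
  rw [offsetValue, edgeWeight, Finset.sum_mul]

/-- With one noise-free outcome for all root-causes, the offset equals the discount caused by noise.
-/
lemma ecedGain_eq_of_const {ε : V → ℝ} (hε : ∀ e θ, M.noiseRate e θ = ε e)
    {ψ : PartialRealization V} (h : 0 < M.mass ψ) {e : V} {t : Bool}
    (ht : ∀ θ, M.noiseFree e θ = t) : M.ecedGain e ψ = 0 := by
  have := M.nonempty_rootCause
  have h2 : 1 - ε e ≠ 0 := by have := M.noise_le_half hε e; intro h; linarith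
  have hp : ∀ x, M.predictive ψ e x = flipLik (ε e) t x := fun x => by
    simp only [M.predictive_eq hε, ht, ← Finset.sum_mul, M.sum_posterior h, one_mul]
  have ho : ∑ x, M.predictive ψ e x * M.offsetValue ψ e x =
      ε e * (1 - (ε e / (1 - ε e)) ^ 2) * M.edgeWeight ψ := by
    simp only [hp, M.offsetValue_eq, M.ratio_eq hε, ht, ciSup_const]
    cases t <;> simp [flipLik, h2] <;> ring
  simp only [ecedGain, mul_sub, Finset.sum_sub_distrib]
  rw [M.sum_predictive_mul_basicValue hε h, ho, tripleWeight_eq_zero (by simp [ht])]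
  ring

/-- Each outcome is noise-free for some root-cause, where the ratio is 1; so the offset vanishes. -/
lemma ecedGain_eq_of_ne {ε : V → ℝ} (hε : ∀ e θ, M.noiseRate e θ = ε e)
    {ψ : PartialRealization V} (h : 0 < M.mass ψ) {e : V}
    (ht : ∀ t, ∃ θ, M.noiseFree e θ = t) :
    M.ecedGain e ψ = ε e * (1 - (ε e / (1 - ε e)) ^ 2) * M.edgeWeight ψ +
      ((1 - 2 * ε e) / (1 - ε e)) ^ 2 *
        (M.mass ψ ^ 2 * tripleWeight M.r (M.posterior ψ) (M.noiseFree e)) := by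
  have := M.nonempty_rootCause
  have h2 : 1 - ε e ≠ 0 := by have := M.noise_le_half hε e; intro h; linarith
  have ho : ∀ x, M.offsetValue ψ e x = 0 := fun x => by
    have : ⨆ θ, M.ratio e θ x ^ 2 = 1 := by
      refine le_antisymm (ciSup_le fun θ => ?_) ?_
      · exact pow_le_one₀ (M.ratio_le_one hε e θ x).1 (M.ratio_le_one hε e θ x).2
      · obtain ⟨θ, hθ⟩ := ht x
        refine le_trans (le_of_eq ?_)
          (le_ciSup (Set.finite_range fun θ => M.ratio e θ x ^ 2).bddAbove θ)
        rw [M.ratio_eq hε, hθ, flipLik, if_pos rfl, div_self h2, one_pow]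
    rw [M.offsetValue_eq, this, sub_self, mul_zero]
  simp only [ecedGain, ho, sub_zero]
  exact M.sum_predictive_mul_basicValue hε h e

/-- For equal noise rates, the tests that maximize the ECED gain maximize the expected weight of the
edges that do not survive the noise-free outcome. -/
lemma tripleWeight_le_of_ecedGain_le {ε : V → ℝ} (hε : ∀ e θ, M.noiseRate e θ = ε e)
    {ψ : PartialRealization V} (h : 0 < M.mass ψ) {e e' : V} (hee : ε e' = ε e)
    (hg : M.ecedGain e' ψ ≤ M.ecedGain e ψ) :
    ((1 - 2 * ε e') / (1 - ε e')) ^ 2 * tripleWeight M.r (M.posterior ψ) (M.noiseFree e') ≤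
      ((1 - 2 * ε e) / (1 - ε e)) ^ 2 * tripleWeight M.r (M.posterior ψ) (M.noiseFree e) := by
  have hT := tripleWeight_nonneg (r := M.r) (M.posterior_nonneg ψ) (M.noiseFree e)
  by_cases h1 : ∃ t, ∀ θ, M.noiseFree e' θ = t
  · obtain ⟨t, ht⟩ := h1
    rw [tripleWeight_eq_zero (ty := M.noiseFree e') (by simp [ht]), mul_zero]
    positivity
  have hcov : ∀ {e : V}, (¬∃ t, ∀ θ, M.noiseFree e θ = t) → ∀ t, ∃ θ, M.noiseFree e θ = t := by
    intro e hc t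
    by_contra hcon
    push Not at hcon
    exact hc ⟨!t, fun θ => Bool.eq_not.2 (hcon θ)⟩
  have h0 := M.noise_nonneg hε e
  have h2 := M.noise_le_half hε e
  have hm : 0 < M.mass ψ ^ 2 := by positivity
  rw [M.ecedGain_eq_of_ne hε h (hcov h1), hee] at hg
  rw [hee]
  refine le_of_mul_le_mul_left ?_ hm
  -- If the chosen test is constant its gain is zero, so both nonnegative terms in the gain of `e'`
  -- must vanish.
  by_cases h3 : ∃ t, ∀ θ, M.noiseFree e θ = t
  · obtain ⟨t, ht⟩ := h3
    rw [M.ecedGain_eq_of_const hε h ht] at hg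
    have hρ : ε e / (1 - ε e) ≤ 1 := by rw [div_le_one (by linarith)]; linarith
    have hρ0 : 0 ≤ ε e / (1 - ε e) := div_nonneg h0 (by linarith)
    have h4 : 0 ≤ ε e * (1 - (ε e / (1 - ε e)) ^ 2) * M.edgeWeight ψ :=
      mul_nonneg (mul_nonneg h0 (sub_nonneg.2 (pow_le_one₀ hρ0 hρ))) (M.edgeWeight_nonneg ψ)
    have h5 : 0 ≤ M.mass ψ ^ 2 * (((1 - 2 * ε e) / (1 - ε e)) ^ 2 *
        tripleWeight M.r (M.posterior ψ) (M.noiseFree e)) := by positivity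
    linarith
  · rw [M.ecedGain_eq_of_ne hε h (hcov h3)] at hg
    linarith

lemma tripleWeight_le_of_ecedGainNoise_le {ε : V → ℝ} (hε : ∀ e θ, M.noiseRate e θ = ε e)
    {ψ : PartialRealization V} (h : 0 < M.mass ψ) {e e' : V}
    (hg : M.ecedGainNoise ε e' ψ ≤ M.ecedGainNoise ε e ψ) :
    ((1 - 2 * ε e') / (1 - ε e')) ^ 2 * tripleWeight M.r (M.posterior ψ) (M.noiseFree e') ≤
      ((1 - 2 * ε e) / (1 - ε e)) ^ 2 * tripleWeight M.r (M.posterior ψ) (M.noiseFree e) := by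
  have hm : 0 < M.mass ψ ^ 2 := by positivity
  rw [M.ecedGainNoise_eq hε h, M.ecedGainNoise_eq hε h] at hg
  refine le_of_mul_le_mul_left ?_ hm
  linarith

/-- Passing from the discounted comparison of two tests with noise rates `a` and `b` to a comparison
with the smallest value of `(1 - 2ε)²`. -/
lemma mul_le_of_discount_le {a b T T' C : ℝ} (ha : a ≤ 1 / 2)
    (hb : b ≤ 1 / 2) (hT : 0 ≤ T) (hT' : 0 ≤ T') (hCa : C ≤ (1 - 2 * a) ^ 2 / 16)
    (hCb : C ≤ (1 - 2 * b) ^ 2 / 16)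
    (h : ((1 - 2 * b) / (1 - b)) ^ 2 * T' ≤ ((1 - 2 * a) / (1 - a)) ^ 2 * T) :
    C * T' ≤ (1 - 2 * a) ^ 2 / 16 * T := by
  have hka : (1 - 2 * a) ^ 2 = ((1 - 2 * a) / (1 - a)) ^ 2 * (1 - a) ^ 2 := by
    rw [← mul_pow, div_mul_cancel₀ _ (by linarith)]
  have hkb : (1 - 2 * b) ^ 2 = ((1 - 2 * b) / (1 - b)) ^ 2 * (1 - b) ^ 2 := by
    rw [← mul_pow, div_mul_cancel₀ _ (by linarith)]
  -- `((1 - 2ε)/(1 - ε))²` is decreasing in `ε`. In both cases `C` is bounded through the noisier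
  -- test.
  rcases le_total b a with hab | hab
  · have hk : ((1 - 2 * a) / (1 - a)) ^ 2 ≤ ((1 - 2 * b) / (1 - b)) ^ 2 := by
      refine pow_le_pow_left₀ (div_nonneg (by linarith) (by linarith)) ?_ 2
      rw [div_le_div_iff₀ (by linarith) (by linarith)]
      linarith
    have h1 : C * T' ≤ (1 - 2 * a) ^ 2 / 16 * T' := mul_le_mul_of_nonneg_right hCa hT'
    have h2 := mul_le_mul_of_nonneg_right hk hT'
    have h3 := mul_le_mul_of_nonneg_right (h2.trans h) (sq_nonneg (1 - a))
    rw [hka] at h1 ⊢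
    linarith
  · have h1 : C * T' ≤ (1 - 2 * b) ^ 2 / 16 * T' := mul_le_mul_of_nonneg_right hCb hT'
    have h3 := mul_le_mul_of_nonneg_right h (sq_nonneg (1 - b))
    have h4 : (1 - b) ^ 2 ≤ (1 - a) ^ 2 := pow_le_pow_left₀ (by linarith) (by linarith) 2
    have h5 : 0 ≤ ((1 - 2 * a) / (1 - a)) ^ 2 * T := by positivity
    have h6 := mul_le_mul_of_nonneg_left h4 h5
    rw [hkb] at h1
    rw [hka]
    linarith

variable [Fintype Y] [DecidableEq V]

lemma testGain_nonneg {ε : V → ℝ} (hε : ∀ e θ, M.noiseRate e θ = ε e) {c : ℝ}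
    (hc : 4 * (2 * (1 + Real.log (Fintype.card Θ)) ^ 2 + 8) ≤ c) {ψ : PartialRealization V}
    {e : V} (he : ψ e = none) (h : 0 < M.mass ψ) : 0 ≤ M.testGain c ψ e := by
  have hl2 : 0 < Real.log 2 := Real.log_pos one_lt_two
  have := crossWeight_nonneg (r := M.r) (M.posterior_nonneg ψ) (M.noiseFree e)
  exact le_trans (by positivity) (M.crossWeight_le_testGain hε hc he h)

lemma three_mul_crossWeight_le_testGain {ε : V → ℝ} (hε : ∀ e θ, M.noiseRate e θ = ε e) {c C : ℝ}
    (hc : 4 * (2 * (1 + Real.log (Fintype.card Θ)) ^ 2 + 8) ≤ c) (hC0 : 0 ≤ C)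
    (hC : ∀ e, C ≤ (1 - 2 * ε e) ^ 2 / 16) {ψ : PartialRealization V} {e e' : V}
    (he : ψ e = none) (h : 0 < M.mass ψ)
    (hT : ((1 - 2 * ε e') / (1 - ε e')) ^ 2 * tripleWeight M.r (M.posterior ψ) (M.noiseFree e') ≤
      ((1 - 2 * ε e) / (1 - ε e)) ^ 2 * tripleWeight M.r (M.posterior ψ) (M.noiseFree e)) :
    3 * (C * crossWeight M.r (M.posterior ψ) (M.noiseFree e')) ≤ M.testGain c ψ e := by
  have hp := M.posterior_nonneg ψ
  have h1 := M.sum_posterior h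
  have hl2 : 0 < Real.log 2 := Real.log_pos one_lt_two
  have key := mul_le_of_discount_le (M.noise_le_half hε e) (M.noise_le_half hε e')
    (tripleWeight_nonneg hp _)
    (tripleWeight_nonneg hp _) (hC e) (hC e') hT
  have h2 := mul_le_mul_of_nonneg_left
    (crossWeight_le_tripleWeight (r := M.r) hp h1 (M.noiseFree e')) hC0
  have h3 := tripleWeight_le (r := M.r) hp (M.noiseFree e)
  rw [h1, one_mul] at h3
  have h4 := mul_le_mul_of_nonneg_left h3 (show 0 ≤ (1 - 2 * ε e) ^ 2 / 16 by positivity)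
  -- One factor 3 is from `tripleWeight_le`, the other from the claim; this is where the constant 16
  -- in `c_ε` suffices.
  have h5 : 9 / 16 ≤ 1 / (2 * Real.log 2) := by
    rw [le_div_iff₀ (by positivity)]
    linarith [Real.log_two_lt_d9]
  have h6 := mul_le_mul_of_nonneg_right h5 (mul_nonneg (sq_nonneg (1 - 2 * ε e))
    (crossWeight_nonneg (r := M.r) hp (M.noiseFree e)))
  have h7 := M.crossWeight_le_testGain hε hc he h
  have h8 : (1 - 2 * ε e) ^ 2 / (2 * Real.log 2) *
      crossWeight M.r (M.posterior ψ) (M.noiseFree e) = 1 / (2 * Real.log 2) *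
      ((1 - 2 * ε e) ^ 2 * crossWeight M.r (M.posterior ψ) (M.noiseFree e)) := by ring
  rw [h8] at h7
  linarith

/-- With `x = log₂ n ≥ 1`, it comes down to `8(1 + x)² + 32 ≤ 8(1 + 2x)²`; dividing by `η < 1` only
helps. -/
lemma le_aux_param {n η : ℝ} (hn : 2 ≤ n) (hη : η ∈ Set.Ioo (0 : ℝ) 1) :
    4 * (2 * (1 + Real.log n) ^ 2 + 8) ≤ 8 * Real.logb 2 (2 * n ^ 2 / η) ^ 2 := by
  have hn0 : 0 < n := by linarith
  have hx1 : 1 ≤ Real.logb 2 n := by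
    rw [Real.le_logb_iff_rpow_le one_lt_two hn0, Real.rpow_one]; exact hn
  have hx2 : Real.log n ≤ Real.logb 2 n := by
    have h := Real.log_two_lt_d9
    rw [Real.logb, le_div_iff₀ (Real.log_pos one_lt_two)]
    nlinarith [Real.log_nonneg (by linarith : (1 : ℝ) ≤ n)]
  have hx3 : 1 + 2 * Real.logb 2 n ≤ Real.logb 2 (2 * n ^ 2 / η) := by
    have e : 1 + 2 * Real.logb 2 n = Real.logb 2 (2 * n ^ 2) := by
      rw [Real.logb_mul (by norm_num) (by positivity), Real.logb_pow,
        Real.logb_self_eq_one one_lt_two]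
      norm_num
    rw [e]
    refine Real.logb_le_logb_of_le one_lt_two (by positivity) ?_
    rw [le_div_iff₀ hη.1]
    exact mul_le_of_le_one_right (by positivity) hη.2.le
  have h4 := pow_le_pow_left₀ (by linarith) hx3 2
  have h5 := pow_le_pow_left₀ (by linarith [Real.log_nonneg (by linarith : (1 : ℝ) ≤ n)])
    (add_le_add_right hx2 1) 2
  nlinarith

/-- The decrease of the auxiliary function in one step of a policy that picks the test with the
largest discounted weight. -/
lemma fAuxAvg_sub_succ_ge {ε : V → ℝ} (hε : ∀ e θ, M.noiseRate e θ = ε e) {η δopt δg C : ℝ}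
    (hη : η ∈ Set.Ioo (0 : ℝ) 1) {π : Policy V} (hπ : M.policyErr π ≤ δopt)
    (hk : 0 < M.cost π) (hδg : 0 < δg) (hC0 : 0 ≤ C) (hC : ∀ e, C ≤ (1 - 2 * ε e) ^ 2 / 16)
    {gain : V → PartialRealization V → ℝ} {σ : Policy V} (hσ : σ.IsGreedy gain)
    (hgain : ∀ ψ, 0 < M.mass ψ → ∀ e e', gain e' ψ ≤ gain e ψ →
      ((1 - 2 * ε e') / (1 - ε e')) ^ 2 * tripleWeight M.r (M.posterior ψ) (M.noiseFree e') ≤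
        ((1 - 2 * ε e) / (1 - ε e)) ^ 2 * tripleWeight M.r (M.posterior ψ) (M.noiseFree e))
    {ℓ : ℕ} (hℓ : δg ≤ M.errAvg σ ℓ) {n c cδ : ℝ} (hn : n = Fintype.card Θ)
    (hc : c = 8 * Real.logb 2 (2 * n ^ 2 / η) ^ 2)
    (hcδ : cδ = (6 * c + 8) * Real.logb 2 (n / δg)) :
    (M.fAuxAvg c σ ℓ - δopt * cδ) / M.cost π * (C / cδ) ≤
      M.fAuxAvg c σ ℓ - M.fAuxAvg c σ (ℓ + 1) := by
  have hne := M.nonempty_rootCause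
  have hn0 : 0 < n := by rw [hn]; exact_mod_cast Fintype.card_pos
  have herr : δg ≤ 1 - 1 / n := hn ▸ hℓ.trans (M.errAvg_le σ ℓ)
  -- A single root-cause would leave no error, against `δg > 0`.
  have hn2 : 2 ≤ n := by
    have h1 : 1 < n := by
      have : 1 / n < 1 := by linarith
      rwa [div_lt_one hn0] at this
    rw [hn] at h1 ⊢
    have : 1 < Fintype.card Θ := by exact_mod_cast h1
    exact_mod_cast this
  have hcc : 4 * (2 * (1 + Real.log (Fintype.card Θ)) ^ 2 + 8) ≤ c := by
    rw [hc, ← hn]; exact le_aux_param hn2 hη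
  have hc0 : 0 ≤ c := by rw [hc]; positivity
  have hcδ0 : 0 < cδ := by
    rw [hcδ]
    refine mul_pos (by linarith) (Real.logb_pos one_lt_two ?_)
    rw [one_lt_div hδg]
    have : 0 < 1 / n := by positivity
    linarith
  have hf : M.fAuxAvg c σ ℓ ≤ cδ * M.errAvg σ ℓ := by
    rw [hcδ, hn]; exact M.fAuxAvg_le hc0 hδg hℓ
  have hk0 : (0 : ℝ) < M.cost π := by exact_mod_cast hk
  have hmain := M.mul_errAvg_sub_policyErr_le (c := c) (σ := σ) hε hC0
    (fun ψ e he => ((hσ ψ).1 e he).1) ?_ ?_ π ℓ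
  · have h1 : (M.fAuxAvg c σ ℓ - δopt * cδ) / cδ ≤ M.errAvg σ ℓ - M.policyErr π := by
      rw [div_le_iff₀ hcδ0]
      nlinarith
    have h2 := (mul_le_mul_of_nonneg_left h1 hC0).trans hmain
    have e : (M.fAuxAvg c σ ℓ - δopt * cδ) / M.cost π * (C / cδ) =
        C * ((M.fAuxAvg c σ ℓ - δopt * cδ) / cδ) / M.cost π := by ring
    rw [e, div_le_iff₀ hk0]
    linarith
  · intro ψ h
    rw [stepGain]
    cases hs : σ ψ with
    | none => exact le_rfl
    | some e => exact M.testGain_nonneg hε hcc ((hσ ψ).1 e hs).1 h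
  · intro ψ h e' he'
    rw [stepGain]
    cases hs : σ ψ with
    | none => exact absurd he' ((hσ ψ).2 hs e')
    | some e =>
      obtain ⟨he, hmax⟩ := (hσ ψ).1 e hs
      exact M.three_mul_crossWeight_le_testGain hε hcc hC0 hC he h (hgain ψ h e e' (hmax e' he'))

end TestModel

end

theorem mainTheorem3 {Θ V Y : Type*} [Fintype Θ] [Fintype V] [DecidableEq V] [Fintype Y]
    [DecidableEq Y] (M : TestModel Θ V Y)
    (ε : V → ℝ) (hε : ∀ e θ, M.noiseRate e θ = ε e)
    (η : ℝ) (hη : η ∈ Set.Ioo (0 : ℝ) 1)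
    (n t c : ℝ) (hn : n = Fintype.card Θ) (ht : t = Fintype.card Y)
    (hc : c = 8 * Real.logb 2 (2 * n ^ 2 / η) ^ 2)
    (δopt : ℝ) (OPT : Policy V) (hOPT : M.IsOptimal δopt OPT)
    (k : ℕ) (hk : k = M.cost OPT) (hk_pos : 0 < k)
    (δg cδ : ℝ) (hδg : 0 < δg) (hcδ : cδ = (6 * c + 8) * Real.logb 2 (n / δg)) :
    (∀ ε₀ : ℝ, (∀ e, ε e = ε₀) →
      ∀ ECED : Policy V, ECED.IsGreedy M.ecedGain → ∀ ℓ : ℕ, δg ≤ M.errAvg ECED ℓ →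
        M.fAuxAvg c ECED ℓ - M.fAuxAvg c ECED (ℓ + 1) ≥
          (M.fAuxAvg c ECED ℓ - δopt * cδ) / k * (((1 - 2 * ε₀) ^ 2 / 16) / cδ) -
            2 * t * (1 - 2 * ε₀) ^ 2 * η) ∧
    (∀ ECED : Policy V, ECED.IsGreedy (M.ecedGainNoise ε) → ∀ ℓ : ℕ, δg ≤ M.errAvg ECED ℓ →
        M.fAuxAvg c ECED ℓ - M.fAuxAvg c ECED (ℓ + 1) ≥
          (M.fAuxAvg c ECED ℓ - δopt * cδ) / k * ((⨅ e, (1 - 2 * ε e) ^ 2 / 16) / cδ) -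
            ⨆ e, 2 * t * (1 - 2 * ε e) ^ 2 * η) := by
  subst hk
  have ht0 : 0 ≤ t := by rw [ht]; positivity
  constructor
  · intro ε₀ hε₀ ECED hG ℓ hℓ
    have h := M.fAuxAvg_sub_succ_ge hε hη hOPT.1 hk_pos hδg
      (C := (1 - 2 * ε₀) ^ 2 / 16) (by positivity) (fun e => by rw [hε₀ e]) hG
      (fun ψ hψ e e' hg => M.tripleWeight_le_of_ecedGain_le hε hψ (by rw [hε₀, hε₀]) hg)
      hℓ hn hc hcδ
    -- The loss term is nonnegative, so subtracting it only weakens the bound.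
    have h2 : 0 ≤ 2 * t * (1 - 2 * ε₀) ^ 2 * η := by have := hη.1; positivity
    linarith
  · intro ECED hG ℓ hℓ
    have h := M.fAuxAvg_sub_succ_ge hε hη hOPT.1 hk_pos hδg
      (C := ⨅ e, (1 - 2 * ε e) ^ 2 / 16) (Real.iInf_nonneg fun e => by positivity)
      (fun e => ciInf_le (Set.finite_range fun e => (1 - 2 * ε e) ^ 2 / 16).bddBelow e) hG
      (fun ψ hψ e e' hg => M.tripleWeight_le_of_ecedGainNoise_le hε hψ hg)
      hℓ hn hc hcδ
    have h2 : 0 ≤ ⨆ e, 2 * t * (1 - 2 * ε e) ^ 2 * η :=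
      Real.iSup_nonneg fun e => by have := hη.1; positivity
    linarith
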